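/- Let $V$ be a finite-dimensional complex affine space and let $\mathcal A=\{H_1,\dots,H_n\}$ ($n\ge 0$) be an arrangement of $n$ distinct affine hyperplanes in $V$, linearly ordered by $H_1<\dots<H_n$. Let $L$ be the set of nonempty intersections $\bigcap_{i\in I}H_i$, $I\subseteq\{1,\dots,n\}$ (with $V$ itself for $I=\emptyset$), ordered by reverse inclusion, and let $r$ be the common codimension of the maximal elements of $L$. The Folkman complex $F$ is the simplicial complex of chains $(X_0>\dots>X_p)$ in $L\setminus\{V\}$. A set $S\subseteq\mathcal A$ is *dependent* if $\bigcap S\neq\emptyset$ and $\operatorname{codim}\bigcap S<|S|$, and *independent* if $\bigcap S\ne\emptyset$ and $S$ is not dependent. A *base* is a maximal independent set (every base has $r$ elements), and a *circuit* is a minimal dependent set. A *broken circuit* is a set $S\subseteq\mathcal A$ for which there is $H\in\mathcal A$ with $H<\min S$ such that $\{H\}\cup S$ is a circuit. An *nbc-base* is a maximal element among the sets $S\subseteq\mathcal A$ that have nonempty intersection and contain no broken circuit. A *$\beta$nbc-base* is a base $B$ that is an nbc-base and such that for every $H\in B$ there is $H'\in\mathcal A$ with $H'<H$ for which $(B\setminus\{H\})\cup\{H'\}$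 is a base. For a base $B=\{H_{i_1},\dots,H_{i_r}\}$ with $i_1<\dots<i_r$ put $\xi(B)=(X_1>\dots>X_r)$, where $X_p=\bigcap_{k=p}^r H_{i_k}$; this is an $(r-1)$-simplex of $F$. Let $R$ be a commutative ring and let $\xi(B)^*\in C^{r-1}(F;R)$ be the dual cochain, equal to $1$ on $\xi(B)$ and to $0$ on every other $(r-1)$-simplex (simplices being written with their vertices in decreasing order). **Theorem.** The cohomology classes $[\xi(B)^*]$, where $B$ ranges over the $\beta$nbc-bases of $\mathcal A$, form a basis of the $R$-module $\tilde H^{r-1}(F;R)$, the reduced simplicial cohomology of $F$ with coefficients in $R$ (where $C^{-1}(F;R)=R$). -/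

import Mathlib

open Module

/-! ### Reduced simplicial cohomology of the complex of chains of a poset -/

section OrderComplex

/-- A flag `(x₁ > ⋯ > xₚ)` of `p` elements of a poset `Q`, that is, a `(p - 1)`-simplex of the
simplicial complex of chains in `Q` with its vertices listed in decreasing order. For `p = 0` this
is the empty simplex. -/
def PosetFlag (Q : Type*) [PartialOrder Q] (p : ℕ) : Type _ :=
  {x : Fin p → Q // StrictAnti x}

namespace PosetFlag

variable {Q : Type*} [PartialOrder Q] {p : ℕ}

/-- The flag obtained by deleting the `i`-th element. -/
def face (x : PosetFlag Q (p + 1)) (i : Fin (p + 1)) : PosetFlag Q p :=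
  ⟨x.1 ∘ i.succAbove, x.2.comp_strictMono (Fin.strictMono_succAbove i)⟩

/-- `PosetFlag.Cochain Q R p` is the module `C^{p-1}` of `R`-valued simplicial cochains in
(geometric) dimension `p - 1` on the complex of chains of `Q`, augmented by `C^{-1} = R`
(functions on the empty simplex). -/
abbrev Cochain (Q : Type*) [PartialOrder Q] (R : Type*) (p : ℕ) : Type _ :=
  PosetFlag Q p → R

/-- The simplicial coboundary map `C^{p-1} → C^p`. For `p = 0` it is the augmentation. -/
def coboundary (Q : Type*) [PartialOrder Q] (R : Type*) [CommRing R] (p : ℕ) :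
    Cochain Q R p →ₗ[R] Cochain Q R (p + 1) where
  toFun f x := ∑ i : Fin (p + 1), (-1 : R) ^ (i : ℕ) * f (x.face i)
  map_add' f g := by
    funext x
    simp [mul_add, Finset.sum_add_distrib]
  map_smul' c f := by
    funext x
    simp only [Pi.smul_apply, smul_eq_mul, RingHom.id_apply, Finset.mul_sum]
    exact Finset.sum_congr rfl fun i _ => by ring

/-- The cocycles in `C^{p-1}`. -/
def cocycles (Q : Type*) [PartialOrder Q] (R : Type*) [CommRing R] (p : ℕ) :
    Submodule R (Cochain Q R p) :=
  LinearMap.ker (coboundary Q R p)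

/-- The coboundaries in `C^{p-1}`; there are none in `C^{-1}`, as `C^{-2} = 0`. -/
def coboundaries (Q : Type*) [PartialOrder Q] (R : Type*) [CommRing R] :
    (p : ℕ) → Submodule R (Cochain Q R p)
  | 0 => ⊥
  | p + 1 => LinearMap.range (coboundary Q R p)

/-- The reduced simplicial cohomology `H̃^{p-1}` with coefficients in `R` of the complex of chains
of `Q`: cocycles in `C^{p-1}` modulo coboundaries. -/
abbrev ReducedCohomology (Q : Type*) [PartialOrder Q] (R : Type*) [CommRing R] (p : ℕ) : Type _ :=
  cocycles Q R p ⧸ (coboundaries Q R p).comap (cocycles Q R p).subtype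

open Classical in
/-- The cochain dual to a simplex `x`: it is `1` on `x` and `0` on all other simplices. -/
noncomputable def dual (R : Type*) [CommRing R] (x : PosetFlag Q p) : Cochain Q R p :=
  fun y => if y = x then 1 else 0

end PosetFlag

end OrderComplex

/-! ### Affine hyperplane arrangements -/

section Arrangement

/-- The codimension of a (nonempty) affine subspace. -/
noncomputable def AffineSubspace.codim {k V P : Type*} [Field k] [AddCommGroup V] [Module k V]
    [AddTorsor V P] (X : AffineSubspace k P) : ℕ :=
  finrank k (V ⧸ X.direction)

/-- An arrangement of `n` distinct affine hyperplanes `H₁, …, Hₙ` in the affine space `P`,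
linearly ordered by their labels. Subsets of the arrangement are given by sets of labels. -/
structure HyperplaneArrangement (k : Type*) {V : Type*} (P : Type*) [Field k] [AddCommGroup V]
    [Module k V] [AddTorsor V P] (n : ℕ) where
  /-- the hyperplane with a given label -/
  hyp : Fin n → AffineSubspace k P
  injective : Function.Injective hyp
  ne_bot : ∀ i, hyp i ≠ ⊥
  codim_hyp : ∀ i, (hyp i).codim = 1

namespace HyperplaneArrangement

variable {k V P : Type*} [Field k] [AddCommGroup V] [Module k V] [AddTorsor V P] {n : ℕ}
  (A : HyperplaneArrangement k P n)

/-- The intersection `H_I` of the hyperplanes with labels in `I`; the whole space for `I = ∅`. -/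
def flat (I : Finset (Fin n)) : AffineSubspace k P := ⨅ i ∈ I, A.hyp i

/-- The intersection poset: the nonempty intersections of hyperplanes of the arrangement,
including the whole space. -/
def IntersectionPoset : Type _ :=
  {X : AffineSubspace k P // X ≠ ⊥ ∧ ∃ I : Finset (Fin n), X = A.flat I}

/-- The intersection poset is ordered by reverse inclusion. -/
instance : PartialOrder A.IntersectionPoset :=
  PartialOrder.lift (fun X => OrderDual.toDual X.1) fun _ _ h =>
    Subtype.ext (OrderDual.toDual.injective h)

open Classical in
/-- The rank `r` of the arrangement: the largest codimension of an element of the intersection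
poset (equivalently, the common codimension of its maximal elements, see `codim_of_isMax`). -/
noncomputable def rank : ℕ :=
  (Finset.univ.filter fun I : Finset (Fin n) => A.flat I ≠ ⊥).sup fun I => (A.flat I).codim

/-- A set of hyperplanes is dependent if its intersection is nonempty, of codimension smaller than
the number of hyperplanes. -/
def IsDependent (I : Finset (Fin n)) : Prop :=
  A.flat I ≠ ⊥ ∧ (A.flat I).codim < I.card

/-- A set of hyperplanes is independent if it has nonempty intersection and is not dependent. -/
def IsIndependent (I : Finset (Fin n)) : Prop :=
  A.flat I ≠ ⊥ ∧ ¬ A.IsDependent I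

/-- A base is a maximal independent set. -/
def IsBase (B : Finset (Fin n)) : Prop := Maximal A.IsIndependent B

/-- A circuit is an inclusion-minimal dependent set. -/
def IsCircuit (C : Finset (Fin n)) : Prop := Minimal A.IsDependent C

/-- A broken circuit is a set `S` such that `{H} ∪ S` is a circuit for some `H < min S`. -/
def IsBrokenCircuit (S : Finset (Fin n)) : Prop :=
  ∃ h : Fin n, (∀ s ∈ S, h < s) ∧ A.IsCircuit (insert h S)

/-- An nbc set (a simplex of the broken circuit complex) is a set of hyperplanes with nonempty
intersection which contains no broken circuit. -/
def IsNbcSet (I : Finset (Fin n)) : Prop :=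
  A.flat I ≠ ⊥ ∧ ∀ S ⊆ I, ¬ A.IsBrokenCircuit S

/-- An nbc-base is a facet (maximal simplex) of the broken circuit complex. -/
def IsNbcBase (B : Finset (Fin n)) : Prop := Maximal A.IsNbcSet B

/-- A base `B` is a βnbc-base if it is an nbc-base and every `H ∈ B` can be exchanged for a
smaller hyperplane `H' < H` such that `(B - {H}) ∪ {H'}` is again a base. -/
def IsBetaNbcBase (B : Finset (Fin n)) : Prop :=
  A.IsBase B ∧ A.IsNbcBase B ∧ ∀ h ∈ B, ∃ h' < h, A.IsBase (insert h' (B.erase h))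

/-- The elements of the intersection poset other than the whole space; the Folkman complex is the
simplicial complex of chains of this poset. -/
abbrev FolkmanVertex : Type _ := {X : A.IntersectionPoset // X.1 ≠ ⊤}

/-! Basic facts about codimension, needed to see that the flag of a base is a flag. -/

theorem flat_empty : A.flat ∅ = ⊤ := by simp [flat]

theorem flat_insert (j : Fin n) (I : Finset (Fin n)) :
    A.flat (insert j I) = A.hyp j ⊓ A.flat I := by
  exact Finset.iInf_insert j I A.hyp

theorem flat_anti {I J : Finset (Fin n)} (h : I ⊆ J) : A.flat J ≤ A.flat I :=
  biInf_mono fun _ hi => h hi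

theorem flat_ne_bot_of_subset {I J : Finset (Fin n)} (h : I ⊆ J) (hJ : A.flat J ≠ ⊥) :
    A.flat I ≠ ⊥ := fun h0 => hJ (le_bot_iff.1 (h0 ▸ A.flat_anti h))

theorem codim_lt [FiniteDimensional k V] {X Y : AffineSubspace k P} (hX : X ≠ ⊥) (h : X < Y) :
    Y.codim < X.codim := by
  have h1 := AffineSubspace.direction_lt_of_nonempty h
    ((AffineSubspace.nonempty_iff_ne_bot X).2 hX)
  have h2 := Submodule.finrank_lt_finrank_of_lt h1
  have h3 := Submodule.finrank_quotient_add_finrank X.direction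
  have h4 := Submodule.finrank_quotient_add_finrank Y.direction
  unfold AffineSubspace.codim
  omega

theorem codim_insert_le [FiniteDimensional k V] {j : Fin n} {I : Finset (Fin n)}
    (h : A.flat (insert j I) ≠ ⊥) : (A.flat (insert j I)).codim ≤ (A.flat I).codim + 1 := by
  rw [flat_insert] at h ⊢
  obtain ⟨p, hp⟩ := (AffineSubspace.nonempty_iff_ne_bot _).2 h
  have h0 := A.codim_hyp j
  have h1 := Submodule.finrank_sup_add_finrank_inf_eq (A.hyp j).direction (A.flat I).direction
  rw [← AffineSubspace.direction_inf_of_mem hp.1 hp.2] at h1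
  have h2 := Submodule.finrank_quotient_add_finrank (A.hyp j).direction
  have h3 := Submodule.finrank_quotient_add_finrank (A.flat I).direction
  have h4 := Submodule.finrank_quotient_add_finrank (A.hyp j ⊓ A.flat I).direction
  have h5 := Submodule.finrank_le ((A.hyp j).direction ⊔ (A.flat I).direction)
  unfold AffineSubspace.codim at *
  omega

theorem codim_union_le [FiniteDimensional k V] (I J : Finset (Fin n)) :
    A.flat (J ∪ I) ≠ ⊥ → (A.flat (J ∪ I)).codim ≤ (A.flat I).codim + J.card := by
  induction J using Finset.induction_on with
  | empty => intro; simp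
  | insert j J hj ih =>
    intro h
    rw [Finset.insert_union] at h ⊢
    have h1 := A.codim_insert_le h
    have h2 := ih (A.flat_ne_bot_of_subset (Finset.subset_insert _ _) h)
    rw [Finset.card_insert_of_notMem hj]
    omega

theorem codim_top : (⊤ : AffineSubspace k P).codim = 0 := by
  unfold AffineSubspace.codim
  rw [AffineSubspace.direction_top]
  exact finrank_zero_of_subsingleton

theorem codim_le_card [FiniteDimensional k V] {I : Finset (Fin n)} (h : A.flat I ≠ ⊥) :
    (A.flat I).codim ≤ I.card := by
  have := A.codim_union_le ∅ I
  simp only [Finset.union_empty, flat_empty, codim_top, zero_add] at this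
  exact this h

theorem IsIndependent.codim_eq [FiniteDimensional k V] {I : Finset (Fin n)}
    (h : A.IsIndependent I) : (A.flat I).codim = I.card :=
  le_antisymm (A.codim_le_card h.1) (not_lt.1 fun h' => h.2 ⟨h.1, h'⟩)

theorem IsIndependent.subset [FiniteDimensional k V] {I J : Finset (Fin n)}
    (h : A.IsIndependent J) (hIJ : I ⊆ J) : A.IsIndependent I := by
  refine ⟨A.flat_ne_bot_of_subset hIJ h.1, fun hd => ?_⟩
  have h1 := A.codim_union_le I (J \ I)
  rw [Finset.sdiff_union_of_subset hIJ, h.codim_eq] at h1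
  have h2 := h1 h.1
  have h3 := Finset.card_sdiff_add_card_eq_card hIJ
  have h4 := hd.2
  omega

theorem codim_le_rank {I : Finset (Fin n)} (h : A.flat I ≠ ⊥) : (A.flat I).codim ≤ A.rank := by
  classical
  unfold rank
  exact Finset.le_sup (f := fun I => (A.flat I).codim) (by simpa using h)

/-- A flat that no further hyperplane cuts properly has codimension `r`. -/
theorem codim_eq_rank [FiniteDimensional k V] {I : Finset (Fin n)} (h : A.flat I ≠ ⊥)
    (hmax : ∀ j, A.flat (insert j I) ≠ ⊥ → A.flat I ≤ A.hyp j) :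
    (A.flat I).codim = A.rank := by
  classical
  refine le_antisymm (A.codim_le_rank h) (Finset.sup_le fun J hJ => ?_)
  have hJ' : A.flat J ≠ ⊥ := by simpa using hJ
  have hpar : ∀ j, (A.flat I).direction ≤ (A.hyp j).direction := by
    intro j
    by_cases hj : A.flat (insert j I) = ⊥
    · by_contra hle
      have hsup : (A.hyp j).direction ⊔ (A.flat I).direction = ⊤ := by
        apply Submodule.eq_top_of_finrank_eq
        have h1 : (A.hyp j).direction < (A.hyp j).direction ⊔ (A.flat I).direction :=
          left_lt_sup.2 hle
        have h2 := Submodule.finrank_lt_finrank_of_lt h1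
        have h3 := Submodule.finrank_quotient_add_finrank (A.hyp j).direction
        have h4 := A.codim_hyp j
        have h5 := Submodule.finrank_le ((A.hyp j).direction ⊔ (A.flat I).direction)
        unfold AffineSubspace.codim at h4
        omega
      have hne := AffineSubspace.inter_nonempty_of_nonempty_of_sup_direction_eq_top
        ((AffineSubspace.nonempty_iff_ne_bot _).2 (A.ne_bot j))
        ((AffineSubspace.nonempty_iff_ne_bot _).2 h) hsup
      rw [flat_insert] at hj
      exact (AffineSubspace.nonempty_iff_ne_bot (A.hyp j ⊓ A.flat I)).1 hne hj
    · exact AffineSubspace.direction_le (hmax j hj)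
  have hdir : (A.flat I).direction ≤ (A.flat J).direction := by
    obtain ⟨p, hp⟩ := (AffineSubspace.nonempty_iff_ne_bot _).2 hJ'
    intro v hv
    rw [← AffineSubspace.vadd_mem_iff_mem_direction v hp]
    have hp' : ∀ j ∈ J, p ∈ A.hyp j := fun j hj =>
      (iInf₂_le j hj : A.flat J ≤ A.hyp j) hp
    have hle : AffineSubspace.mk' (v +ᵥ p) ⊥ ≤ A.flat J := by
      refine le_iInf₂ fun j hj q hq => ?_
      have hq' : q = v +ᵥ p := by simpa [AffineSubspace.mem_mk'] using hq
      rw [hq']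
      exact AffineSubspace.vadd_mem_of_mem_direction (hpar j hv) (hp' j hj)
    exact hle (AffineSubspace.self_mem_mk' _ _)
  have h1 := Submodule.finrank_mono hdir
  have h2 := Submodule.finrank_quotient_add_finrank (A.flat I).direction
  have h3 := Submodule.finrank_quotient_add_finrank (A.flat J).direction
  unfold AffineSubspace.codim
  omega

/-- All maximal elements of the intersection poset have codimension `r`. -/
theorem codim_of_isMax [FiniteDimensional k V] {X : A.IntersectionPoset} (hX : IsMax X) :
    X.1.codim = A.rank := by
  obtain ⟨X, h, I, rfl⟩ := X
  refine A.codim_eq_rank h fun j hj => ?_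
  have h1 : A.flat I ≤ A.flat (insert j I) :=
    @hX ⟨A.flat (insert j I), hj, _, rfl⟩ (A.flat_anti (Finset.subset_insert _ _))
  exact h1.trans (by rw [flat_insert]; exact inf_le_left)

/-- Every base has cardinality `r`. -/
theorem IsBase.card_eq [FiniteDimensional k V] {B : Finset (Fin n)} (hB : A.IsBase B) :
    B.card = A.rank := by
  rw [← hB.prop.codim_eq]
  refine A.codim_eq_rank hB.prop.1 fun j hj => ?_
  by_contra hle
  have hjB : j ∉ B := fun h => hle (iInf₂_le j h)
  have h1 : A.flat (insert j B) < A.flat B :=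
    lt_of_le_of_ne (A.flat_anti (Finset.subset_insert _ _)) fun h => hle
      (h ▸ (by rw [flat_insert]; exact inf_le_left))
  have h2 := codim_lt hj h1
  have h3 : A.IsIndependent (insert j B) := ⟨hj, fun hd => by
    have := hd.2
    rw [Finset.card_insert_of_notMem hjB, ← hB.prop.codim_eq] at this
    omega⟩
  exact hjB (hB.2 h3 (Finset.subset_insert _ _) (Finset.mem_insert_self _ _))

/-- For a base `B = {H_{i_1}, …, H_{i_r}}` with `i_1 < ⋯ < i_r`, the set of labels
`{i_p, …, i_r}`. -/
noncomputable def lastLabels [FiniteDimensional k V] {B : Finset (Fin n)} (hB : A.IsBase B)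
    (p : Fin A.rank) : Finset (Fin n) :=
  (Finset.Ici p).map (B.orderEmbOfFin (IsBase.card_eq A hB)).toEmbedding

theorem isIndependent_lastLabels [FiniteDimensional k V] {B : Finset (Fin n)} (hB : A.IsBase B)
    (p : Fin A.rank) : A.IsIndependent (A.lastLabels hB p) := by
  refine IsIndependent.subset A hB.prop fun i hi => ?_
  obtain ⟨q, -, rfl⟩ := Finset.mem_map.1 hi
  exact B.orderEmbOfFin_mem (IsBase.card_eq A hB) q

theorem codim_lastLabels [FiniteDimensional k V] {B : Finset (Fin n)} (hB : A.IsBase B)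
    (p : Fin A.rank) : (A.flat (A.lastLabels hB p)).codim = A.rank - p := by
  rw [(A.isIndependent_lastLabels hB p).codim_eq, lastLabels, Finset.card_map, Fin.card_Ici]

/-- The flag `ξ(B) = (X_1 > ⋯ > X_r)` of a base `B = {H_{i_1}, …, H_{i_r}}`, `i_1 < ⋯ < i_r`,
where `X_p = H_{i_p} ∩ ⋯ ∩ H_{i_r}`. It is an `(r - 1)`-simplex of the Folkman complex. -/
noncomputable def xi [FiniteDimensional k V] {B : Finset (Fin n)} (hB : A.IsBase B) :
    PosetFlag A.FolkmanVertex A.rank :=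
  ⟨fun p => ⟨⟨A.flat (A.lastLabels hB p), (A.isIndependent_lastLabels hB p).1, _, rfl⟩, fun h => by
      have h1 := A.codim_lastLabels hB p
      have h2 := p.2
      rw [show A.flat (A.lastLabels hB p) = ⊤ from h, codim_top] at h1
      omega⟩,
    fun p q hpq => by
      have h1 : A.flat (A.lastLabels hB p) ≤ A.flat (A.lastLabels hB q) :=
        A.flat_anti (Finset.map_subset_map.2 (Finset.Ici_subset_Ici.2 hpq.le))
      have h2 : A.flat (A.lastLabels hB p) ≠ A.flat (A.lastLabels hB q) := fun h => by
        have h3 := A.codim_lastLabels hB p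
        have h4 := A.codim_lastLabels hB q
        rw [h] at h3
        have := p.2
        have := q.2
        have : (p : ℕ) < q := hpq
        omega
      exact (show A.flat (A.lastLabels hB p) < A.flat (A.lastLabels hB q) from
        lt_of_le_of_ne h1 h2)⟩

/-- The Folkman complex has no simplices of dimension `r`. -/
theorem isEmpty_posetFlag [FiniteDimensional k V] :
    IsEmpty (PosetFlag A.FolkmanVertex (A.rank + 1)) := by
  refine ⟨fun x => ?_⟩
  have hinj : Function.Injective fun i => (x.1 i).1.1.codim := by
    apply StrictAnti.injective
    intro i j hij
    exact codim_lt (x.1 i).1.2.1 (x.2 hij)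
  have hmem : ∀ i, (x.1 i).1.1.codim ∈ Finset.Icc 1 A.rank := by
    intro i
    obtain ⟨⟨X, hX, I, rfl⟩, ht⟩ := x.1 i
    refine Finset.mem_Icc.2 ⟨?_, A.codim_le_rank hX⟩
    exact Nat.one_le_iff_ne_zero.2 (Nat.ne_zero_of_lt (codim_lt hX (lt_top_iff_ne_top.2 ht)))
  have := Finset.card_le_card_of_injOn (s := Finset.univ) _ (fun i _ => hmem i) hinj.injOn
  simp at this

/-- The reduced cohomology `H̃^{r-1}` of the Folkman complex with coefficients in `R`. -/
abbrev FolkmanCohomology (R : Type*) [CommRing R] : Type _ :=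
  PosetFlag.ReducedCohomology A.FolkmanVertex R A.rank

/-- The class in `H̃^{r-1}` of an `(r - 1)`-cochain of the Folkman complex; every such cochain is a
cocycle, there being no `r`-simplices. -/
noncomputable def cohomologyClass [FiniteDimensional k V] {R : Type*} [CommRing R]
    (f : PosetFlag.Cochain A.FolkmanVertex R A.rank) : A.FolkmanCohomology R :=
  Submodule.Quotient.mk ⟨f, LinearMap.mem_ker.2 (funext fun x => (A.isEmpty_posetFlag.false x).elim)⟩

end HyperplaneArrangement

end Arrangement

/-! ### Matroid-like exchange properties of affine arrangements and nbc sets -/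

namespace HyperplaneArrangement

variable {k V P : Type*} [Field k] [AddCommGroup V] [Module k V] [AddTorsor V P] {n : ℕ}
  (A : HyperplaneArrangement k P n)

/-! In top degree every cochain is a cocycle, so the cohomology is spanned by the dual classes of
maximal flags. Deleting one vertex of a maximal flag gives a relation: the classes obtained by
letting that vertex vary sum to zero (`sum_flats_mem_coboundaries`).

The relations whose free place is not the first (the smallest subspace) reduce every flag to flags
of nbc bases (`mem_span_flagList`). The coefficients of this reduction are the signed sums `flagSum`
over the orderings of a base: these respect the same relations (`flagSum_append_free`) and are dual
to the flags of nbc bases (`flagSum_single_flagList`). The relations with the first place free then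
say that, for each codimension one face of an nbc base, the signed sum of the nbc bases containing
it vanishes (`sum_faceSign_listClass`). The question has thus moved to the top cohomology of the
broken circuit complex.

That complex is shelled by the lexicographic order of the nbc bases (`isShelling_nbcBases`), and the
βnbc-bases are the facets all of whose codimension one faces lie in earlier facets. If `C` is not of
this kind, the relation of a face of `C` lying in no earlier facet expresses the class of `C`
through later bases; this gives spanning (`listClass_mem_span`). If `C` is a βnbc-base, its boundary
can be filled by earlier facets, which yields a cycle with coefficient 1 at `C`. Cycles pair to zero
with coboundaries through `flagSum` (`sum_mul_flagSum_eq_zero`), and the matrix of these cycles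
against the classes is unitriangular, which gives independence over any commutative ring. -/

theorem eq_of_le_of_codim_le [FiniteDimensional k V] {X Y : AffineSubspace k P} (hX : X ≠ ⊥)
    (h : X ≤ Y) (hc : X.codim ≤ Y.codim) : X = Y := by
  by_contra hne
  exact absurd (codim_lt hX (lt_of_le_of_ne h hne)) (not_lt.2 hc)

theorem flat_le_hyp {I : Finset (Fin n)} {i : Fin n} (hi : i ∈ I) : A.flat I ≤ A.hyp i :=
  iInf₂_le i hi

theorem flat_union (I J : Finset (Fin n)) : A.flat (I ∪ J) = A.flat I ⊓ A.flat J :=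
  Finset.iInf_union

theorem not_top_le_hyp (i : Fin n) : ¬ ⊤ ≤ A.hyp i := fun h => by
  have h1 := A.codim_hyp i
  rw [top_le_iff.1 h, codim_top] at h1
  omega

theorem isIndependent_iff {I : Finset (Fin n)} :
    A.IsIndependent I ↔ A.flat I ≠ ⊥ ∧ I.card ≤ (A.flat I).codim := by
  unfold IsIndependent IsDependent
  constructor
  · rintro ⟨h, h'⟩
    exact ⟨h, not_lt.1 fun hlt => h' ⟨h, hlt⟩⟩
  · rintro ⟨h, h'⟩
    exact ⟨h, fun hd => absurd hd.2 (not_lt.2 h')⟩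

theorem exists_isCircuit_subset {I : Finset (Fin n)} (h : A.IsDependent I) :
    ∃ C ⊆ I, A.IsCircuit C := by
  obtain ⟨C, hC, hmin⟩ := exists_minimal_le_of_wellFoundedLT A.IsDependent I h
  exact ⟨C, hC, hmin⟩

theorem IsNbcSet.subset {A : HyperplaneArrangement k P n} {S T : Finset (Fin n)}
    (h : A.IsNbcSet T) (hST : S ⊆ T) : A.IsNbcSet S :=
  ⟨A.flat_ne_bot_of_subset hST h.1, fun U hU => h.2 U (hU.trans hST)⟩

/-- A dependent set contains a circuit, and a circuit without its least element is a broken circuit.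
-/
theorem IsNbcSet.isIndependent {A : HyperplaneArrangement k P n} {S : Finset (Fin n)}
    (h : A.IsNbcSet S) : A.IsIndependent S := by
  refine ⟨h.1, fun hd => ?_⟩
  obtain ⟨C, hCS, hC⟩ := A.exists_isCircuit_subset hd
  have hne : C.Nonempty := by
    rw [Finset.nonempty_iff_ne_empty]
    rintro rfl
    simpa using hC.prop.2
  refine h.2 (C.erase (C.min' hne)) ((Finset.erase_subset _ _).trans hCS) ⟨C.min' hne, ?_, ?_⟩
  · intro s hs
    exact C.min'_lt_of_mem_erase_min' hne hs
  · rwa [Finset.insert_erase (C.min'_mem hne)]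

/-- A set with nonempty intersection is an nbc set if and only if each of its nonempty subsets `T`
contains the smallest hyperplane through the intersection of `T`. -/
theorem isNbcSet_iff [FiniteDimensional k V] {S : Finset (Fin n)} :
    A.IsNbcSet S ↔ A.flat S ≠ ⊥ ∧ ∀ T ⊆ S, T.Nonempty → ∀ i, A.flat T ≤ A.hyp i →
      ∃ t ∈ T, t ≤ i := by
  constructor
  · intro h
    refine ⟨h.1, fun T hT hne i hi => ?_⟩
    by_contra! hlt
    have hTi := (h.subset hT).isIndependent
    have hiT : i ∉ T := fun hmem => lt_irrefl _ (hlt i hmem)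
    have hflat : A.flat (insert i T) = A.flat T := by
      rw [flat_insert]
      exact inf_eq_right.2 hi
    -- `T` is independent, so a circuit in `insert i T` passes through `i`; since `i` lies below all
    -- of `T`, dropping `i` from it leaves a broken circuit inside `T`.
    have hd : A.IsDependent (insert i T) := by
      refine ⟨hflat ▸ hTi.1, ?_⟩
      rw [hflat, hTi.codim_eq, Finset.card_insert_of_notMem hiT]
      omega
    obtain ⟨C, hCT, hC⟩ := A.exists_isCircuit_subset hd
    have hiC : i ∈ C := by
      by_contra hiC
      exact (hTi.subset A ((Finset.subset_insert_iff_of_notMem hiC).1 hCT)).2 hC.prop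
    have hsub : C.erase i ⊆ T := Finset.subset_insert_iff.1 hCT
    exact h.2 (C.erase i) (hsub.trans hT)
      ⟨i, fun s hs => hlt s (hsub hs), by rwa [Finset.insert_erase hiC]⟩
  · rintro ⟨h0, h⟩
    refine ⟨h0, fun T hT => ?_⟩
    rintro ⟨i, hi, hC⟩
    have hiT : i ∉ T := fun hmem => lt_irrefl _ (hi i hmem)
    have hTi : A.IsIndependent T := by
      refine ⟨A.flat_ne_bot_of_subset hT h0, fun hd => ?_⟩
      exact hiT (hC.2 hd (Finset.subset_insert i T) (Finset.mem_insert_self i T))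
    have heq : A.flat (insert i T) = A.flat T := by
      refine eq_of_le_of_codim_le hC.prop.1 (A.flat_anti (Finset.subset_insert _ _)) ?_
      have := hC.prop.2
      rw [Finset.card_insert_of_notMem hiT] at this
      rw [hTi.codim_eq]
      omega
    have hle : A.flat T ≤ A.hyp i := heq ▸ A.flat_le_hyp (Finset.mem_insert_self i T)
    have hne : T.Nonempty := by
      rw [Finset.nonempty_iff_ne_empty]
      rintro rfl
      rw [flat_empty] at hle
      exact A.not_top_le_hyp i hle
    obtain ⟨t, ht, hti⟩ := h T hT hne i hle
    exact absurd (hi t ht) (not_lt.2 hti)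

theorem isNbcSet_empty [FiniteDimensional k V] : A.IsNbcSet ∅ := by
  rw [isNbcSet_iff]
  refine ⟨?_, fun T hT hne => absurd (Finset.subset_empty.1 hT) hne.ne_empty⟩
  rw [flat_empty]
  exact (AffineSubspace.bot_ne_top k V P).symm

theorem isBase_iff [FiniteDimensional k V] {B : Finset (Fin n)} :
    A.IsBase B ↔ A.IsIndependent B ∧ B.card = A.rank := by
  constructor
  · intro h
    exact ⟨h.prop, IsBase.card_eq A h⟩
  · rintro ⟨h, hc⟩
    refine ⟨h, fun J hJ hBJ => ?_⟩
    have h1 := A.codim_le_rank hJ.1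
    rw [hJ.codim_eq, ← hc] at h1
    exact (Finset.eq_of_subset_of_card_le hBJ h1).ge

/-- Nbc sets are independent, so a base that is nbc is automatically maximal among nbc sets. -/
theorem isBetaNbcBase_iff [FiniteDimensional k V] {B : Finset (Fin n)} :
    A.IsBetaNbcBase B ↔ A.IsBase B ∧ A.IsNbcSet B ∧
      ∀ h ∈ B, ∃ h' < h, A.IsBase (insert h' (B.erase h)) := by
  unfold IsBetaNbcBase
  refine and_congr_right fun hB => and_congr_left fun _ => ?_
  constructor
  · exact fun h => h.prop
  · exact fun h => ⟨h, fun J hJ hBJ => hB.2 hJ.isIndependent hBJ⟩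

/-- A hyperplane not parallel to a flat has, together with it, directions spanning the whole space;
hence it meets the flat and cuts it properly. This is what makes matroid arguments work although
intersections may be empty. -/
theorem isIndependent_insert [FiniteDimensional k V] {I : Finset (Fin n)} {j : Fin n}
    (hI : A.IsIndependent I) (h : ¬ (A.flat I).direction ≤ (A.hyp j).direction) :
    A.IsIndependent (insert j I) ∧ j ∉ I := by
  have hle : ¬ A.flat I ≤ A.hyp j := fun hle => h (AffineSubspace.direction_le hle)
  have hj : j ∉ I := fun hmem => hle (A.flat_le_hyp hmem)
  have hsup : (A.hyp j).direction ⊔ (A.flat I).direction = ⊤ := by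
    apply Submodule.eq_top_of_finrank_eq
    have h1 : (A.hyp j).direction < (A.hyp j).direction ⊔ (A.flat I).direction :=
      left_lt_sup.2 h
    have h2 := Submodule.finrank_lt_finrank_of_lt h1
    have h3 := Submodule.finrank_quotient_add_finrank (A.hyp j).direction
    have h4 := A.codim_hyp j
    have h5 := Submodule.finrank_le ((A.hyp j).direction ⊔ (A.flat I).direction)
    unfold AffineSubspace.codim at h4
    omega
  have hne := AffineSubspace.inter_nonempty_of_nonempty_of_sup_direction_eq_top
    ((AffineSubspace.nonempty_iff_ne_bot _).2 (A.ne_bot j))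
    ((AffineSubspace.nonempty_iff_ne_bot _).2 hI.1) hsup
  have hbot : A.flat (insert j I) ≠ ⊥ := by
    rw [flat_insert]
    exact (AffineSubspace.nonempty_iff_ne_bot (A.hyp j ⊓ A.flat I)).1 hne
  have hlt : A.flat (insert j I) < A.flat I := by
    rw [flat_insert]
    exact inf_lt_right.2 hle
  refine ⟨A.isIndependent_iff.2 ⟨hbot, ?_⟩, hj⟩
  have h2 := codim_lt hbot hlt
  rw [hI.codim_eq] at h2
  rw [Finset.card_insert_of_notMem hj]
  omega

theorem direction_le_direction_flat {D : Submodule k V} {J : Finset (Fin n)} (hJ : A.flat J ≠ ⊥)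
    (h : ∀ j ∈ J, D ≤ (A.hyp j).direction) : D ≤ (A.flat J).direction := by
  obtain ⟨p, hp⟩ := (AffineSubspace.nonempty_iff_ne_bot _).2 hJ
  intro v hv
  rw [← AffineSubspace.vadd_mem_iff_mem_direction v hp]
  have hle : AffineSubspace.mk' (v +ᵥ p) ⊥ ≤ A.flat J := by
    refine le_iInf₂ fun j hj q hq => ?_
    have hq' : q = v +ᵥ p := by simpa [AffineSubspace.mem_mk'] using hq
    rw [hq']
    exact AffineSubspace.vadd_mem_of_mem_direction (h j hj hv) (A.flat_le_hyp hj hp)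
  exact hle (AffineSubspace.self_mem_mk' _ _)

/-- The augmentation property of independent sets. -/
theorem exists_isIndependent_insert [FiniteDimensional k V] {I J : Finset (Fin n)}
    (hI : A.IsIndependent I) (hJ : A.IsIndependent J) (h : I.card < J.card) :
    ∃ j ∈ J, j ∉ I ∧ A.IsIndependent (insert j I) := by
  by_contra! hcon
  -- If nothing in `J` augments `I`, every hyperplane of `J` is parallel to the flat of `I`, against
  -- the dimension count.
  have hle : (A.flat I).direction ≤ (A.flat J).direction := by
    refine A.direction_le_direction_flat hJ.1 fun j hj => ?_
    by_contra hle
    have := A.isIndependent_insert hI hle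
    exact hcon j hj this.2 this.1
  have h1 := Submodule.finrank_mono hle
  have h2 := Submodule.finrank_quotient_add_finrank (A.flat I).direction
  have h3 := Submodule.finrank_quotient_add_finrank (A.flat J).direction
  have h4 := hI.codim_eq
  have h5 := hJ.codim_eq
  unfold AffineSubspace.codim at h4 h5
  omega

theorem exists_isBase_between [FiniteDimensional k V] {I C : Finset (Fin n)}
    (hI : A.IsIndependent I) (hC : A.IsBase C) : ∃ D, A.IsBase D ∧ I ⊆ D ∧ D ⊆ I ∪ C := by
  obtain ⟨D, hID, hD⟩ := exists_maximal_ge_of_wellFoundedGT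
    (fun D => A.IsIndependent D ∧ I ⊆ D ∧ D ⊆ I ∪ C) I ⟨hI, subset_rfl, Finset.subset_union_left⟩
  refine ⟨D, A.isBase_iff.2 ⟨hD.prop.1, ?_⟩, hD.prop.2⟩
  have h1 := A.codim_le_rank hD.prop.1.1
  rw [hD.prop.1.codim_eq] at h1
  by_contra hne
  obtain ⟨j, hjC, hjD, hj⟩ := A.exists_isIndependent_insert hD.prop.1 hC.prop
    (by rw [IsBase.card_eq A hC]; omega)
  refine hjD (hD.2 ⟨hj, hID.trans (Finset.subset_insert _ _), ?_⟩ (Finset.subset_insert _ _)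
    (Finset.mem_insert_self _ _))
  exact Finset.insert_subset (Finset.mem_union_right _ hjC) hD.prop.2.2

/-- The exchange property of bases. -/
theorem exists_isBase_exchange [FiniteDimensional k V] {B C : Finset (Fin n)} (hB : A.IsBase B)
    (hC : A.IsBase C) {b : Fin n} (hbB : b ∈ B) (hbC : b ∉ C) :
    ∃ c ∈ C, c ∉ B ∧ A.IsBase (insert b (C.erase c)) := by
  -- Extend `{b} ∪ (B ∩ C)` to a base `D` using elements of `C` only. The element of `C` missing
  -- from `D` is the one exchanged, and it is not in `B` because `D` contains `B ∩ C`.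
  have hI : insert b (B ∩ C) ⊆ B := Finset.insert_subset hbB Finset.inter_subset_left
  obtain ⟨D, hD, hID, hDC⟩ := A.exists_isBase_between (hB.prop.subset A hI) hC
  have hDC' : D ⊆ insert b C := by
    refine hDC.trans fun x hx => ?_
    simp only [Finset.mem_union, Finset.mem_insert, Finset.mem_inter] at hx ⊢
    tauto
  have hbD : b ∈ D := hID (Finset.mem_insert_self _ _)
  have hcard : D.card = C.card := by rw [IsBase.card_eq A hD, IsBase.card_eq A hC]
  obtain ⟨c, hc, hcD⟩ : ∃ c ∈ C, c ∉ D := by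
    by_contra! hsub
    have := Finset.eq_of_subset_of_card_le (s := C) (t := D) hsub hcard.le
    exact hbC (this ▸ hbD)
  refine ⟨c, hc, fun hcB => hcD (hID ?_), ?_⟩
  · simp [hcB, hc]
  · have hsub : D ⊆ insert b (C.erase c) := by
      intro x hx
      have h1 := hDC' hx
      have h2 : x ≠ c := fun h => hcD (h ▸ hx)
      simp only [Finset.mem_insert, Finset.mem_erase] at h1 ⊢
      tauto
    have h1 : (insert b (C.erase c)).card ≤ D.card := by
      refine (Finset.card_insert_le _ _).trans ?_
      rw [Finset.card_erase_add_one hc, hcard]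
    rwa [← Finset.eq_of_subset_of_card_le hsub h1]

/-- If an element of an nbc base can be exchanged for a smaller one, then this can be done so
that the new base is again nbc. -/
theorem exists_isNbcSet_exchange [FiniteDimensional k V] {C : Finset (Fin n)} {c c' : Fin n}
    (hC : A.IsNbcSet C) (hc : c ∈ C) (hlt : c' < c)
    (hbase : A.IsBase (insert c' (C.erase c))) :
    ∃ h < c, A.IsBase (insert h (C.erase c)) ∧ A.IsNbcSet (insert h (C.erase c)) := by
  -- The least possible replacement works: a violation of the nbc condition would produce a still
  -- smaller replacement `i`.
  obtain ⟨h, hle, hmin⟩ := exists_minimal_le_of_wellFoundedLT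
    (fun h => A.IsBase (insert h (C.erase c))) c' hbase
  refine ⟨h, hle.trans_lt hlt, hmin.prop, ?_⟩
  rw [isNbcSet_iff]
  refine ⟨hmin.prop.prop.1, fun T hT hne i hi => ?_⟩
  have hE : A.IsNbcSet (C.erase c) := hC.subset (Finset.erase_subset _ _)
  by_cases hhT : h ∈ T
  swap
  · exact ((A.isNbcSet_iff).1 hE).2 T ((Finset.subset_insert_iff_of_notMem hhT).1 hT) hne i hi
  by_contra! hlt'
  set E := C.erase c
  have hT0 : T.erase h ⊆ E := Finset.subset_insert_iff.1 hT
  have hle0 : ¬ A.flat (T.erase h) ≤ A.hyp i := by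
    intro hle0
    rcases (T.erase h).eq_empty_or_nonempty with h0 | h0
    · rw [h0, flat_empty] at hle0
      exact A.not_top_le_hyp i hle0
    · obtain ⟨t, ht, hti⟩ := ((A.isNbcSet_iff).1 hE).2 _ hT0 h0 i hle0
      exact absurd (hlt' t (Finset.mem_of_mem_erase ht)) (not_lt.2 hti)
  have hTi : A.IsIndependent T := hmin.prop.prop.subset A hT
  have hTbot := hTi.1
  have hTle : A.flat T ≤ A.flat (insert i (T.erase h)) := by
    rw [flat_insert]
    exact le_inf hi (A.flat_anti (Finset.erase_subset _ _))
  have hibot : A.flat (insert i (T.erase h)) ≠ ⊥ := fun h0 => hTbot (le_bot_iff.1 (h0 ▸ hTle))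
  have hilt : A.flat (insert i (T.erase h)) < A.flat (T.erase h) := by
    rw [flat_insert]
    exact inf_lt_right.2 hle0
  -- Given the rest of `T`, the hyperplanes `h` and `i` cut out the same flat; this persists after
  -- adding the rest of `E`, so `i` can replace `h`.
  have heq : A.flat T = A.flat (insert i (T.erase h)) := by
    refine eq_of_le_of_codim_le hTbot hTle ?_
    have h1 := codim_lt hibot hilt
    rw [(hTi.subset A (Finset.erase_subset h T)).codim_eq] at h1
    rw [hTi.codim_eq, ← Finset.card_erase_add_one hhT]
    omega
  have heq2 : A.flat (insert i E) = A.flat (insert h E) := by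
    have h1 : insert i E = insert i (T.erase h) ∪ E := by
      rw [Finset.insert_union, Finset.union_eq_right.2 hT0]
    have h2 : insert h E = T ∪ E := by
      ext x
      simp only [Finset.mem_insert, Finset.mem_union]
      constructor
      · rintro (rfl | hx)
        · exact Or.inl hhT
        · exact Or.inr hx
      · rintro (hx | hx)
        · exact Finset.mem_insert.1 (hT hx)
        · exact Or.inr hx
    rw [h1, h2, flat_union, flat_union, heq]
  have hbase' : A.IsBase (insert i E) := by
    have hcod : (A.flat (insert i E)).codim = A.rank := by
      rw [heq2, hmin.prop.prop.codim_eq, IsBase.card_eq A hmin.prop]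
    have hne' : A.flat (insert i E) ≠ ⊥ := heq2 ▸ hmin.prop.prop.1
    have hcard : (insert i E).card ≤ A.rank := by
      refine (Finset.card_insert_le _ _).trans ?_
      have h1 := A.codim_le_rank hC.1
      rw [hC.isIndependent.codim_eq] at h1
      have h2 := Finset.card_erase_add_one hc
      exact h2.trans_le h1
    have hind : A.IsIndependent (insert i E) :=
      A.isIndependent_iff.2 ⟨hne', hcod ▸ hcard⟩
    exact A.isBase_iff.2 ⟨hind, by rw [← hind.codim_eq, hcod]⟩
  exact absurd (hmin.2 hbase' (hlt' h hhT).le) (not_le.2 (hlt' h hhT))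

end HyperplaneArrangement

/-! ### Signs of faces and their cancellation -/

section SimplicialSigns

variable {α : Type*} [LinearOrder α] (R : Type*) [CommRing R]

/-- The sign of the face of `insert j S` opposite to the vertex `j`. -/
def faceSign (S : Finset α) (j : α) : R := (-1) ^ (S.filter (· < j)).card

theorem faceSign_mul_self (S : Finset α) (j : α) : faceSign R S j * faceSign R S j = 1 := by
  unfold faceSign
  rw [← mul_pow]
  simp

theorem faceSign_eq_one {S : Finset α} {j : α} (h : ∀ s ∈ S, j ≤ s) : faceSign R S j = 1 := by
  unfold faceSign
  rw [Finset.filter_false_of_mem fun s hs => not_lt.2 (h s hs)]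
  simp

theorem faceSign_insert_self (S : Finset α) (j : α) :
    faceSign R (insert j S) j = faceSign R S j := by
  unfold faceSign
  rw [Finset.filter_insert, if_neg (lt_irrefl j)]

theorem faceSign_erase_self (S : Finset α) (j : α) :
    faceSign R (S.erase j) j = faceSign R S j := by
  by_cases hj : j ∈ S
  · conv_rhs => rw [← Finset.insert_erase hj, faceSign_insert_self]
  · rw [Finset.erase_eq_of_notMem hj]

theorem faceSign_insert_of_lt {S : Finset α} {i j : α} (hi : i ∉ S) (h : i < j) :
    faceSign R (insert i S) j = - faceSign R S j := by
  unfold faceSign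
  rw [Finset.filter_insert, if_pos h, Finset.card_insert_of_notMem (by simp [hi]), pow_succ]
  simp

theorem faceSign_insert_of_gt {S : Finset α} {i j : α} (h : j < i) :
    faceSign R (insert i S) j = faceSign R S j := by
  unfold faceSign
  rw [Finset.filter_insert, if_neg h.not_gt]

theorem faceSign_insert_antisymm {S : Finset α} {i j : α} (hi : i ∉ S) (hj : j ∉ S)
    (hij : i ≠ j) :
    faceSign R S i * faceSign R (insert i S) j = - (faceSign R S j * faceSign R (insert j S) i) := by
  rcases lt_or_gt_of_ne hij with h | h
  · rw [faceSign_insert_of_lt R hi h, faceSign_insert_of_gt R h]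
    ring
  · rw [faceSign_insert_of_lt R hj h, faceSign_insert_of_gt R h]
    ring

theorem faceSign_erase_antisymm {S : Finset α} {i j : α} (hi : i ∈ S) (hj : j ∈ S)
    (hij : i ≠ j) :
    faceSign R S i * faceSign R (S.erase i) j = - (faceSign R S j * faceSign R (S.erase j) i) := by
  have h := faceSign_insert_antisymm R (S := (S.erase i).erase j) (i := i) (j := j) (by simp)
    (by simp) hij
  have h1 : insert i ((S.erase i).erase j) = S.erase j := by
    rw [Finset.erase_right_comm, Finset.insert_erase (by simp [hi, hij])]
  have h2 : insert j ((S.erase i).erase j) = S.erase i := by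
    rw [Finset.insert_erase (by simp [hj, hij.symm])]
  have h3 : faceSign R ((S.erase i).erase j) i = faceSign R (S.erase j) i := by
    rw [← h1, faceSign_insert_self]
  have h4 : faceSign R ((S.erase i).erase j) j = faceSign R (S.erase i) j := by
    rw [faceSign_erase_self]
  rw [h1, h2, h3, h4, faceSign_erase_self, faceSign_erase_self] at h
  linear_combination h

variable {R}

/-- Swapping the two indices is a fixed-point-free involution on ordered pairs of distinct elements,
so terms cancel in pairs and 2 need not be invertible. -/
theorem sum_erase_eq_zero_of_antisymm (S : Finset α) (F : α → α → R)
    (h : ∀ i ∈ S, ∀ j ∈ S, i ≠ j → F i j = - F j i) :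
    ∑ i ∈ S, ∑ j ∈ S.erase i, F i j = 0 := by
  rw [Finset.sum_sigma']
  refine Finset.sum_involution (fun x _ => ⟨x.2, x.1⟩) ?_ ?_ ?_ ?_
  · rintro ⟨i, j⟩ hx
    simp only [Finset.mem_sigma, Finset.mem_erase] at hx
    simp only
    rw [h i hx.1 j hx.2.2 hx.2.1.symm]
    ring
  · rintro ⟨i, j⟩ hx - heq
    simp only [Finset.mem_sigma, Finset.mem_erase] at hx
    simp only [Sigma.mk.injEq, heq_eq_eq] at heq
    exact hx.2.1 heq.1
  · rintro ⟨i, j⟩ hx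
    simp only [Finset.mem_sigma, Finset.mem_erase] at hx ⊢
    exact ⟨hx.2.2, hx.2.1.symm, hx.1⟩
  · rintro ⟨i, j⟩ hx
    rfl

/-- The usual `∂² = 0` cancellation: two vertices removed in either order leave the same set, with
opposite signs. -/
theorem sum_faceSign_erase_erase (S : Finset α) (G : Finset α → R) :
    ∑ i ∈ S, faceSign R S i *
      ∑ j ∈ S.erase i, faceSign R (S.erase i) j * G ((S.erase i).erase j) = 0 := by
  simp only [Finset.mul_sum]
  refine sum_erase_eq_zero_of_antisymm S _ fun i hi j hj hij => ?_
  rw [← mul_assoc, faceSign_erase_antisymm R hi hj hij, Finset.erase_right_comm]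
  ring

end SimplicialSigns

/-! ### Homology of shellable complexes -/

section Shelling

variable {α : Type*} [LinearOrder α] [Fintype α] {R : Type*} [CommRing R]

variable (R) in
/-- The simplicial boundary of chains on the full simplex with vertex set `α`; a chain is given by
its coefficients. -/
def simplexBoundary : (Finset α → R) →ₗ[R] (Finset α → R) where
  toFun w S := ∑ x ∈ Sᶜ, faceSign R S x * w (insert x S)
  map_add' f g := by
    funext S
    simp [mul_add, Finset.sum_add_distrib]
  map_smul' c f := by
    funext S
    simp only [Pi.smul_apply, smul_eq_mul, RingHom.id_apply, Finset.mul_sum]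
    exact Finset.sum_congr rfl fun i _ => by ring

theorem simplexBoundary_apply (w : Finset α → R) (S : Finset α) :
    simplexBoundary R w S = ∑ x ∈ Sᶜ, faceSign R S x * w (insert x S) := rfl

theorem simplexBoundary_simplexBoundary (w : Finset α → R) :
    simplexBoundary R (simplexBoundary R w) = 0 := by
  funext S
  simp only [simplexBoundary_apply, Finset.mul_sum, Finset.compl_insert, Pi.zero_apply]
  refine sum_erase_eq_zero_of_antisymm Sᶜ _ fun i hi j hj hij => ?_
  rw [← mul_assoc, faceSign_insert_antisymm R (Finset.mem_compl.1 hi) (Finset.mem_compl.1 hj) hij,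
    Finset.insert_comm]
  ring

theorem sum_sum_mem_eq_sum_sum_compl (F : Finset α → α → R) :
    ∑ C, ∑ j ∈ C, F C j = ∑ S, ∑ x ∈ Sᶜ, F (insert x S) x := by
  rw [Finset.sum_sigma', Finset.sum_sigma']
  refine Finset.sum_bij' (fun p _ => ⟨p.1.erase p.2, p.2⟩) (fun p _ => ⟨insert p.2 p.1, p.2⟩)
    ?_ ?_ ?_ ?_ ?_
  · rintro ⟨C, j⟩ h
    simp
  · rintro ⟨S, x⟩ h
    simp
  · rintro ⟨C, j⟩ h
    simp only [Finset.mem_sigma, Finset.mem_univ, true_and] at h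
    simp [Finset.insert_erase h]
  · rintro ⟨S, x⟩ h
    simp only [Finset.mem_sigma, Finset.mem_univ, true_and, Finset.mem_compl] at h
    simp [Finset.erase_insert h]
  · rintro ⟨C, j⟩ h
    simp only [Finset.mem_sigma, Finset.mem_univ, true_and] at h
    simp [Finset.insert_erase h]

/-- The boundary is adjoint to the coboundary. -/
theorem sum_mul_coboundary (z G : Finset α → R) :
    ∑ C, z C * ∑ j ∈ C, faceSign R C j * G (C.erase j) = ∑ S, simplexBoundary R z S * G S := by
  simp only [Finset.mul_sum, simplexBoundary_apply, Finset.sum_mul]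
  rw [sum_sum_mem_eq_sum_sum_compl]
  refine Finset.sum_congr rfl fun S _ => Finset.sum_congr rfl fun x hx => ?_
  rw [faceSign_insert_self, Finset.erase_insert (Finset.mem_compl.1 hx)]
  ring

theorem simplexBoundary_single_erase {C : Finset α} {c : α} (hc : c ∈ C) :
    simplexBoundary R (Pi.single C 1) (C.erase c) = faceSign R C c := by
  rw [simplexBoundary_apply, Finset.sum_eq_single c]
  · rw [Finset.insert_erase hc, Pi.single_eq_same, mul_one, faceSign_erase_self]
  · intro x hx hxc
    rw [Pi.single_eq_of_ne, mul_zero]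
    intro h
    rw [← h] at hc
    simp [hxc.symm] at hc
  · simp

theorem eq_erase_of_simplexBoundary_single_ne_zero {C S : Finset α}
    (h : simplexBoundary R (Pi.single C 1) S ≠ 0) : ∃ c ∈ C, S = C.erase c := by
  rw [simplexBoundary_apply] at h
  obtain ⟨x, hx, hne⟩ := Finset.exists_ne_zero_of_sum_ne_zero h
  have hC : insert x S = C := by
    by_contra hC
    rw [Pi.single_eq_of_ne hC, mul_zero] at hne
    exact hne rfl
  refine ⟨x, hC ▸ Finset.mem_insert_self x S, ?_⟩
  rw [← hC, Finset.erase_insert (Finset.mem_compl.1 hx)]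

/-- The facets in `F`, ordered by `f`, form a shelling of a pure simplicial complex all of whose
facets have `r` vertices. -/
structure IsShelling {β : Type*} [LinearOrder β] (f : Finset α → β) (r : ℕ)
    (F : Finset (Finset α)) : Prop where
  card_eq : ∀ C ∈ F, C.card = r
  exists_erase_subset : ∀ C ∈ F, ∀ B ∈ F, f B < f C →
    ∃ c ∈ C, c ∉ B ∧ ∃ B' ∈ F, f B' < f C ∧ C.erase c ⊆ B'

variable {β : Type*} [LinearOrder β] {f : Finset α → β} {r : ℕ}

/-- A shellable complex with facets of `r` vertices has no homology in the degree of simplices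
with `r - 1` vertices. -/
theorem IsShelling.exists_simplexBoundary_eq (hf : Function.Injective f) (F : Finset (Finset α)) :
    IsShelling f r F → ∀ w : Finset α → R, (∀ S, w S ≠ 0 → S.card + 1 = r ∧ ∃ B ∈ F, S ⊆ B) →
      simplexBoundary R w = 0 →
      ∃ z : Finset α → R, (∀ C, z C ≠ 0 → C ∈ F) ∧ simplexBoundary R z = w := by
  induction F using Finset.induction_on_max_value f with
  | empty =>
    intro _ w hw _
    refine ⟨0, by simp, ?_⟩
    rw [map_zero]
    funext S
    by_contra hne
    obtain ⟨-, B, hB, -⟩ := hw S (Ne.symm hne)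
    simp at hB
  | insert C F hCF hmax ih =>
    intro hsh w hw hcyc
    have hlt : ∀ B ∈ F, f B < f C := fun B hB => lt_of_le_of_ne (hmax B hB) fun h =>
      hCF (hf h ▸ hB)
    have hmem : ∀ B ∈ insert C F, ∀ D ∈ insert C F, f B < f D → B ∈ F := by
      intro B hB D hD hBD
      refine (Finset.mem_insert.1 hB).resolve_left ?_
      rintro rfl
      rcases Finset.mem_insert.1 hD with rfl | hD
      · exact lt_irrefl _ hBD
      · exact lt_asymm hBD (hlt D hD)
    have hcC := hsh.card_eq C (Finset.mem_insert_self _ _)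
    have hsh' : IsShelling f r F := by
      refine ⟨fun B hB => hsh.card_eq B (Finset.mem_insert_of_mem hB), fun D hD B hB hBD => ?_⟩
      obtain ⟨c, hc, hcB, B', hB', hB'D, hsub⟩ := hsh.exists_erase_subset D
        (Finset.mem_insert_of_mem hD) B (Finset.mem_insert_of_mem hB) hBD
      exact ⟨c, hc, hcB, B', hmem B' hB' D (Finset.mem_insert_of_mem hD) hB'D, hB'D, hsub⟩
    have hC : ∀ B ∈ F, ∃ c ∈ C, c ∉ B ∧ ∃ B' ∈ F, C.erase c ⊆ B' := by
      intro B hB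
      obtain ⟨c, hc, hcB, B', hB', hB'D, hsub⟩ := hsh.exists_erase_subset C
        (Finset.mem_insert_self _ _) B (Finset.mem_insert_of_mem hB) (hlt B hB)
      exact ⟨c, hc, hcB, B', hmem B' hB' C (Finset.mem_insert_self _ _) hB'D, hsub⟩
    -- A face of `C` or of `F` which lies in a facet of `F` as soon as it is not a new face of `C`.
    have hold : ∀ w' : Finset α → R, (∀ S, w' S ≠ 0 → S.card + 1 = r ∧ ∃ B ∈ insert C F, S ⊆ B) →
        (∀ c ∈ C, (¬ ∃ B' ∈ F, C.erase c ⊆ B') → w' (C.erase c) = 0) →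
        ∀ S, w' S ≠ 0 → S.card + 1 = r ∧ ∃ B ∈ F, S ⊆ B := by
      intro w' hw' hnew S hS
      obtain ⟨hcard, B, hB, hSB⟩ := hw' S hS
      refine ⟨hcard, ?_⟩
      rcases Finset.mem_insert.1 hB with rfl | hB
      · obtain ⟨c, hcS, rfl⟩ := Finset.exists_eq_insert_iff.2 ⟨hSB, hcard.trans hcC.symm⟩
        by_contra hcon
        apply hS
        have := hnew c (Finset.mem_insert_self c S)
        rw [Finset.erase_insert hcS] at this
        exact this hcon
      · exact ⟨B, hB, hSB⟩
    by_cases hR : ∀ c ∈ C, ∃ B' ∈ F, C.erase c ⊆ B'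
    · obtain ⟨z, hz, hzw⟩ := ih hsh' w (hold w hw fun c hc h => absurd (hR c hc) h) hcyc
      exact ⟨z, fun D hD => Finset.mem_insert_of_mem (hz D hD), hzw⟩
    · push Not at hR
      obtain ⟨c₀, hc₀, hc₀R⟩ := hR
      -- The face `C.erase c₀` is new. As the sign squares to 1, subtracting `a` times the boundary
      -- of `C` makes the coefficient at this face vanish.
      set a : R := w (C.erase c₀) * faceSign R C c₀
      set w' : Finset α → R := w - a • simplexBoundary R (Pi.single C 1) with hw'def
      have hw' : ∀ S, w' S ≠ 0 → S.card + 1 = r ∧ ∃ B ∈ insert C F, S ⊆ B := by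
        intro S hS
        by_cases h0 : w S = 0
        · have h1 : simplexBoundary R (Pi.single C 1) S ≠ 0 := by
            intro h1
            simp [hw'def, h0, h1] at hS
          obtain ⟨c, hc, rfl⟩ := eq_erase_of_simplexBoundary_single_ne_zero h1
          exact ⟨by rw [Finset.card_erase_add_one hc, hcC], C, Finset.mem_insert_self _ _,
            Finset.erase_subset _ _⟩
        · exact hw S h0
      have hcyc' : simplexBoundary R w' = 0 := by
        rw [hw'def, map_sub, map_smul, hcyc, simplexBoundary_simplexBoundary]
        simp
      have h0 : w' (C.erase c₀) = 0 := by
        rw [hw'def, Pi.sub_apply, Pi.smul_apply, simplexBoundary_single_erase hc₀, smul_eq_mul,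
          mul_assoc, faceSign_mul_self, mul_one, sub_self]
      -- Killing one new face kills them all. In the cycle equation at `C` minus `{c, c₀}`, the only
      -- terms that can survive belong to `C.erase c` and `C.erase c₀`, and the latter is zero.
      have hnew : ∀ c ∈ C, (¬ ∃ B' ∈ F, C.erase c ⊆ B') → w' (C.erase c) = 0 := by
        intro c hc hcR
        rcases eq_or_ne c c₀ with rfl | hne
        · exact h0
        have h1 := congrFun hcyc' ((C.erase c).erase c₀)
        rw [simplexBoundary_apply, Finset.sum_eq_single c₀] at h1
        · rw [Finset.insert_erase (by simp [hc₀, hne.symm]), Pi.zero_apply] at h1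
          have h2 := congrArg (faceSign R ((C.erase c).erase c₀) c₀ * ·) h1
          simpa only [← mul_assoc, faceSign_mul_self, one_mul, mul_zero] using h2
        · intro x hx hxc₀
          by_contra hne0
          have hx' : w' (insert x ((C.erase c).erase c₀)) ≠ 0 := fun h => hne0 (by rw [h, mul_zero])
          obtain ⟨-, B, hB, hsub⟩ := hw' _ hx'
          rcases Finset.mem_insert.1 hB with rfl | hB
          · have hxC := hsub (Finset.mem_insert_self _ _)
            have hxc : x = c := by
              by_contra hxc
              simp [hxC, hxc, hxc₀] at hx
            subst hxc
            apply hx'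
            rw [Finset.erase_right_comm, Finset.insert_erase (by simp [hc, hne])]
            exact h0
          -- A further term would come from an earlier facet `B` containing `C` minus `{c, c₀}`. The
          -- shelling condition gives `d ∈ C` outside `B` with `C.erase d` an old face; but `d` must
          -- be `c` or `c₀`, whose faces are new.
          · obtain ⟨d, hd, hdB, B', hB', hdB'⟩ := hC B hB
            have hd' : d ∉ (C.erase c).erase c₀ := fun h =>
              hdB (hsub (Finset.mem_insert_of_mem h))
            rcases eq_or_ne d c with rfl | hdc
            · exact hcR ⟨B', hB', hdB'⟩
            · rcases eq_or_ne d c₀ with rfl | hdc₀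
              · exact hc₀R B' hB' hdB'
              · simp [hd, hdc, hdc₀] at hd'
        · simp
      obtain ⟨z, hz, hzw⟩ := ih hsh' w' (hold w' hw' hnew) hcyc'
      refine ⟨z + a • Pi.single C 1, fun D hD => ?_, ?_⟩
      · by_contra hDF
        rw [Finset.mem_insert, not_or] at hDF
        apply hD
        have : z D = 0 := by
          by_contra h
          exact hDF.2 (hz D h)
        simp [this, hDF.1]
      · rw [map_add, map_smul, hzw, hw'def]
        simp

/-- A facet of a shelling whose codimension one faces all lie in earlier facets carries a cycle
supported on itself and on earlier facets. -/
theorem IsShelling.exists_cycle (hf : Function.Injective f) {F : Finset (Finset α)}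
    (hsh : IsShelling f r F) {C : Finset α} (hC : C ∈ F)
    (h : ∀ c ∈ C, ∃ B ∈ F, f B < f C ∧ C.erase c ⊆ B) :
    ∃ z : Finset α → R, (∀ D, z D ≠ 0 → D ∈ F ∧ f D ≤ f C) ∧ z C = 1 ∧
      simplexBoundary R z = 0 := by
  have hsh' : IsShelling f r (F.filter (f · < f C)) := by
    refine ⟨fun D hD => hsh.card_eq D (Finset.mem_filter.1 hD).1, fun D hD B hB hBD => ?_⟩
    obtain ⟨c, hc, hcB, B', hB', hB'D, hsub⟩ := hsh.exists_erase_subset D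
      (Finset.mem_filter.1 hD).1 B (Finset.mem_filter.1 hB).1 hBD
    exact ⟨c, hc, hcB, B', Finset.mem_filter.2 ⟨hB', hB'D.trans (Finset.mem_filter.1 hD).2⟩,
      hB'D, hsub⟩
  have hw : ∀ S, simplexBoundary R (Pi.single C 1) S ≠ 0 →
      S.card + 1 = r ∧ ∃ B ∈ F.filter (f · < f C), S ⊆ B := by
    intro S hS
    obtain ⟨c, hc, rfl⟩ := eq_erase_of_simplexBoundary_single_ne_zero hS
    obtain ⟨B, hB, hBC, hsub⟩ := h c hc
    exact ⟨by rw [Finset.card_erase_add_one hc, hsh.card_eq C hC], B,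
      Finset.mem_filter.2 ⟨hB, hBC⟩, hsub⟩
  -- The boundary of `C` is a cycle on the earlier facets; `y` fills it there, and `C - y` is the
  -- required cycle.
  obtain ⟨y, hy, hyw⟩ := hsh'.exists_simplexBoundary_eq hf _ _ hw
    (simplexBoundary_simplexBoundary _)
  refine ⟨Pi.single C 1 - y, fun D hD => ?_, ?_, ?_⟩
  · rcases eq_or_ne D C with rfl | hne
    · exact ⟨hC, le_rfl⟩
    · have h1 := Finset.mem_filter.1 (hy D (by simpa [hne] using hD))
      exact ⟨h1.1, h1.2.le⟩
  · have : y C = 0 := by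
      by_contra hne
      exact lt_irrefl _ (Finset.mem_filter.1 (hy C hne)).2
    simp [this]
  · rw [map_sub, hyw, sub_self]

end Shelling

/-! ### The lexicographic order of finite sets -/

/-- The key by which finite sets are ordered lexicographically, `B` being smaller than `C` if the
least element of their symmetric difference lies in `B`. -/
def Finset.lexKey {α : Type*} (B : Finset α) : (Colex (Finset αᵒᵈ))ᵒᵈ :=
  OrderDual.toDual (toColex (B.map OrderDual.toDual.toEmbedding))

theorem Finset.lexKey_injective {α : Type*} :
    Function.Injective (Finset.lexKey : Finset α → (Colex (Finset αᵒᵈ))ᵒᵈ) := fun B C h => by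
  have h1 := toColex.injective (OrderDual.toDual.injective h)
  exact Finset.map_injective _ h1

/-- Colex looks at the largest element where two sets differ and calls the set containing it larger;
the inner dual turns largest into least, the outer one reverses the verdict. -/
theorem Finset.lexKey_lt_iff {α : Type*} [LinearOrder α] {B C : Finset α} :
    B.lexKey < C.lexKey ↔ ∃ b ∈ B, b ∉ C ∧ ∀ c ∈ C, c ∉ B → b < c := by
  unfold Finset.lexKey
  rw [OrderDual.toDual_lt_toDual, Finset.Colex.toColex_lt_toColex_iff_exists_forall_lt]
  constructor
  · rintro ⟨b, hb, hbC, h⟩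
    refine ⟨OrderDual.ofDual b, by simpa using hb, by simpa using hbC, fun c hc hcB => ?_⟩
    exact h (OrderDual.toDual c) (by simpa using hc) (by simpa using hcB)
  · rintro ⟨b, hb, hbC, h⟩
    refine ⟨OrderDual.toDual b, by simpa using hb, by simpa using hbC, fun c hc hcB => ?_⟩
    exact h (OrderDual.ofDual c) (by simpa using hc) (by simpa using hcB)

namespace HyperplaneArrangement

variable {k V P : Type*} [Field k] [AddCommGroup V] [Module k V] [AddTorsor V P] {n : ℕ}
  (A : HyperplaneArrangement k P n)

/-! ### Shelling of the broken circuit complex and the cycles of βnbc-bases -/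

section NbcComplex

open Classical in
/-- The bases which are nbc sets. -/
noncomputable def nbcBases : Finset (Finset (Fin n)) :=
  Finset.univ.filter fun B => A.IsBase B ∧ A.IsNbcSet B

theorem mem_nbcBases {B : Finset (Fin n)} : B ∈ A.nbcBases ↔ A.IsBase B ∧ A.IsNbcSet B := by
  simp [nbcBases]

theorem notMem_of_isBase_exchange [FiniteDimensional k V] {C : Finset (Fin n)} {c h : Fin n}
    (hC : A.IsBase C) (hc : c ∈ C) (hne : h ≠ c) (hB : A.IsBase (insert h (C.erase c))) :
    h ∉ C := by
  intro hh
  have h1 := IsBase.card_eq A hB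
  rw [Finset.insert_eq_of_mem (by simp [hh, hne]), ← IsBase.card_eq A hC] at h1
  have := Finset.card_erase_lt_of_mem hc
  omega

/-- The exchanged set differs from `C` only by `c` and a smaller label, hence precedes it
lexicographically. This yields both the shelling condition and the old faces of a βnbc-base. -/
theorem exists_nbcBases_exchange [FiniteDimensional k V] {C : Finset (Fin n)} {b c : Fin n}
    (hC : C ∈ A.nbcBases) (hc : c ∈ C) (hlt : b < c) (hbase : A.IsBase (insert b (C.erase c))) :
    ∃ B ∈ A.nbcBases, B.lexKey < C.lexKey ∧ C.erase c ⊆ B := by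
  rw [mem_nbcBases] at hC
  obtain ⟨h, hhc, hB, hBn⟩ := A.exists_isNbcSet_exchange hC.2 hc hlt hbase
  refine ⟨insert h (C.erase c), A.mem_nbcBases.2 ⟨hB, hBn⟩, ?_, Finset.subset_insert _ _⟩
  refine Finset.lexKey_lt_iff.2 ⟨h, Finset.mem_insert_self _ _,
    A.notMem_of_isBase_exchange hC.1 hc hhc.ne hB, fun x hx hxB => ?_⟩
  have : x = c := by
    by_contra hne
    simp [hx, hne] at hxB
  rwa [this]

/-- The lexicographic order of the nbc bases is a shelling of the broken circuit complex. -/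
theorem isShelling_nbcBases [FiniteDimensional k V] :
    IsShelling Finset.lexKey A.rank A.nbcBases := by
  refine ⟨fun C hC => IsBase.card_eq A (A.mem_nbcBases.1 hC).1, fun C hC B hB hBC => ?_⟩
  -- `b` is the least element of the symmetric difference, so whatever element of `C` outside `B` it
  -- is exchanged for is larger.
  obtain ⟨b, hbB, hbC, hb⟩ := Finset.lexKey_lt_iff.1 hBC
  obtain ⟨c, hc, hcB, hbase⟩ := A.exists_isBase_exchange (A.mem_nbcBases.1 hB).1
    (A.mem_nbcBases.1 hC).1 hbB hbC
  exact ⟨c, hc, hcB, A.exists_nbcBases_exchange hC hc (hb c hc hcB) hbase⟩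

theorem IsBetaNbcBase.mem_nbcBases [FiniteDimensional k V] {A : HyperplaneArrangement k P n}
    {B : Finset (Fin n)} (hB : A.IsBetaNbcBase B) : B ∈ A.nbcBases := by
  rw [isBetaNbcBase_iff] at hB
  exact A.mem_nbcBases.2 ⟨hB.1, hB.2.1⟩

/-- A βnbc-base carries a cycle of the broken circuit complex supported on itself and on
lexicographically smaller nbc bases. -/
theorem IsBetaNbcBase.exists_cycle [FiniteDimensional k V] {A : HyperplaneArrangement k P n}
    (R : Type*) [CommRing R] {C : Finset (Fin n)} (hC : A.IsBetaNbcBase C) :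
    ∃ z : Finset (Fin n) → R, (∀ D, z D ≠ 0 → D ∈ A.nbcBases ∧ D.lexKey ≤ C.lexKey) ∧
      z C = 1 ∧ simplexBoundary R z = 0 := by
  refine A.isShelling_nbcBases.exists_cycle Finset.lexKey_injective hC.mem_nbcBases
    fun c hc => ?_
  obtain ⟨b, hb, hbase⟩ := (A.isBetaNbcBase_iff.1 hC).2.2 c hc
  exact A.exists_nbcBases_exchange hC.mem_nbcBases hc hb hbase

end NbcComplex

/-! ### Signed sums over the flags of all orderings -/

section FlagSum

variable (R : Type*) [CommRing R]

/-- The signed sum of the values of a function on the flags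
`⋂ {i₁, …, iₚ} < ⋂ {i₂, …, iₚ} < ⋯ < ⋂ {iₚ}` (as sets) for all orderings `i₁, …, iₚ` of a set of
`p` labels. -/
noncomputable def flagSum : ℕ → Finset (Fin n) → (List (AffineSubspace k P) → R) →ₗ[R] R
  | 0, _ => LinearMap.proj []
  | p + 1, S => ∑ j ∈ S, faceSign R S j •
      (flagSum p (S.erase j) ∘ₗ LinearMap.funLeft R R (A.flat S :: ·))

theorem flagSum_zero (S : Finset (Fin n)) (f : List (AffineSubspace k P) → R) :
    A.flagSum R 0 S f = f [] := rfl

theorem flagSum_succ (p : ℕ) (S : Finset (Fin n)) (f : List (AffineSubspace k P) → R) :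
    A.flagSum R (p + 1) S f =
      ∑ j ∈ S, faceSign R S j * A.flagSum R p (S.erase j) (fun l => f (A.flat S :: l)) := by
  simp only [flagSum, LinearMap.sum_apply, LinearMap.smul_apply, LinearMap.comp_apply,
    smul_eq_mul]
  rfl

variable {R}

/-- The simplicial coboundary of a function on lists. -/
def listCoboundary {α : Type*} : List α → (List α → R) → R
  | [], _ => 0
  | x :: l, g => g l - listCoboundary l fun m => g (x :: m)

theorem listCoboundary_eq_sum {α : Type*} (l : List α) :
    ∀ g : List α → R,
      listCoboundary l g = ∑ i ∈ Finset.range l.length, (-1) ^ i * g (l.eraseIdx i) := by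
  induction l with
  | nil => intro g; simp [listCoboundary]
  | cons x l ih =>
    intro g
    rw [listCoboundary, ih, List.length_cons, Finset.sum_range_succ']
    simp only [List.eraseIdx_cons_succ, List.eraseIdx_cons_zero, pow_succ, pow_zero, one_mul,
      mul_neg, mul_one, neg_mul, Finset.sum_neg_distrib]
    ring

/-- `flagSum` turns the coboundary of flags into the coboundary of sets of labels. -/
theorem flagSum_listCoboundary (p : ℕ) :
    ∀ (S : Finset (Fin n)) (g : List (AffineSubspace k P) → R),
      A.flagSum R (p + 1) S (fun l => listCoboundary l g) =
        ∑ j ∈ S, faceSign R S j * A.flagSum R p (S.erase j) g := by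
  induction p with
  | zero =>
    intro S g
    simp [flagSum_succ, flagSum_zero, listCoboundary]
  | succ p ih =>
    intro S g
    rw [flagSum_succ]
    have h : ∀ j ∈ S, A.flagSum R (p + 1) (S.erase j)
          (fun l => listCoboundary (A.flat S :: l) g) =
        A.flagSum R (p + 1) (S.erase j) g - ∑ i ∈ S.erase j, faceSign R (S.erase j) i *
          A.flagSum R p ((S.erase j).erase i) (fun m => g (A.flat S :: m)) := by
      intro j _
      rw [← ih, ← map_sub]
      rfl
    -- Only deletion of the first vertex contributes; the deletions further down remove two labels
    -- in both orders and cancel.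
    rw [Finset.sum_congr rfl fun j hj => by rw [h j hj, mul_sub], Finset.sum_sub_distrib,
      sum_faceSign_erase_erase S fun T => A.flagSum R p T fun m => g (A.flat S :: m), sub_zero]

open Classical in
/-- `flagSum` kills the sum of all flags with one place left free, other than the first. -/
theorem flagSum_append_free (s : Finset (AffineSubspace k P)) (hs : ∀ I, A.flat I ∈ s) (p : ℕ) :
    ∀ (S : Finset (Fin n)) (l₁ l₂ : List (AffineSubspace k P)), l₁ ≠ [] →
      ∀ c : List (AffineSubspace k P) → R,
      (∀ l, c l = ∑ Y ∈ s, (Pi.single (l₁ ++ Y :: l₂) 1 : List (AffineSubspace k P) → R) l) → A.flagSum R p S c = 0 := by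
  induction p with
  | zero =>
    intro S l₁ l₂ h₁ c hc
    rw [flagSum_zero, hc]
    exact Finset.sum_eq_zero fun Y _ => Pi.single_eq_of_ne (by simp) _
  | succ p ih =>
    intro S l₁ l₂ h₁ c hc
    obtain ⟨x, l₁, rfl⟩ := List.exists_cons_of_ne_nil h₁
    rw [flagSum_succ]
    by_cases hx : A.flat S = x
    swap
    · refine Finset.sum_eq_zero fun j _ => ?_
      have : (fun l => c (A.flat S :: l)) = 0 := by
        funext l
        rw [hc]
        exact Finset.sum_eq_zero fun Y _ => Pi.single_eq_of_ne (by simp [hx]) _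
      rw [this, map_zero, mul_zero]
    rcases eq_or_ne l₁ [] with rfl | h
    · cases p with
      | zero =>
        refine Finset.sum_eq_zero fun j _ => ?_
        rw [flagSum_zero, hc, Finset.sum_eq_zero fun Y _ => Pi.single_eq_of_ne (by simp) _,
          mul_zero]
      | succ p =>
        -- With the second place free, only the choice `Y = A.flat (S.erase j)` contributes. What is
        -- left depends only on the set without `j` and `i`, so the two orders of removal cancel.
        rw [← sum_faceSign_erase_erase S fun T => A.flagSum R p T (Pi.single l₂ 1)]
        refine Finset.sum_congr rfl fun j _ => ?_
        rw [flagSum_succ]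
        congr 1
        refine Finset.sum_congr rfl fun i _ => ?_
        congr 2
        funext l
        rw [hc, Finset.sum_eq_single (A.flat (S.erase j))]
        · simp [Pi.single_apply, hx]
        · intro Y _ hY
          exact Pi.single_eq_of_ne (by simp [hY.symm]) _
        · intro h
          exact absurd (hs _) h
    · refine Finset.sum_eq_zero fun j _ => ?_
      rw [ih (S.erase j) l₁ l₂ h, mul_zero]
      intro l
      rw [hc]
      simp [Pi.single_apply, hx]

-- A free first place is not killed: only the flat of `S` itself fits there, and the coboundary on
-- sets of labels remains. These are the relations of the broken circuit complex.
open Classical in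
theorem flagSum_free (s : Finset (AffineSubspace k P)) (hs : ∀ I, A.flat I ∈ s) (p : ℕ)
    (S : Finset (Fin n)) (l : List (AffineSubspace k P)) :
    ∑ Y ∈ s, A.flagSum R (p + 1) S (Pi.single (Y :: l) 1) =
      ∑ j ∈ S, faceSign R S j * A.flagSum R p (S.erase j) (Pi.single l 1) := by
  rw [← map_sum, flagSum_succ]
  refine Finset.sum_congr rfl fun j _ => ?_
  congr 2
  funext m
  rw [Finset.sum_apply, Finset.sum_eq_single (A.flat S)]
  · simp [Pi.single_apply]
  · intro Y _ hY
    exact Pi.single_eq_of_ne (by simp [hY.symm]) _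
  · intro h
    exact absurd (hs _) h

end FlagSum

/-! ### Flags of sets of labels and their duality with signed sums -/

section FlagList

/-- The flats `⋂ {i₁, …, iₚ}, ⋂ {i₂, …, iₚ}, …, ⋂ {iₚ}` of a list of labels. -/
noncomputable def tailFlats : List (Fin n) → List (AffineSubspace k P)
  | [] => []
  | i :: l => A.flat (i :: l).toFinset :: tailFlats l

/-- The list of flats of the flag `ξ(S)` of a set of labels. -/
noncomputable def flagList (S : Finset (Fin n)) : List (AffineSubspace k P) :=
  A.tailFlats (S.sort (· ≤ ·))

theorem flagList_empty : A.flagList ∅ = [] := by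
  simp [flagList, tailFlats]

theorem flagList_insert {S : Finset (Fin n)} {h : Fin n} (hS : ∀ s ∈ S, h < s) :
    A.flagList (insert h S) = A.flat (insert h S) :: A.flagList S := by
  unfold flagList
  rw [Finset.sort_insert _ (fun b hb => (hS b hb).le) (fun hmem => lt_irrefl _ (hS h hmem)),
    tailFlats]
  simp

theorem flagList_of_mem {S : Finset (Fin n)} {h : Fin n} (hh : h ∈ S) (hS : ∀ s ∈ S, h ≤ s) :
    A.flagList S = A.flat S :: A.flagList (S.erase h) := by
  have h1 := A.flagList_insert (S := S.erase h) (h := h) fun s hs =>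
    lt_of_le_of_ne (hS s (Finset.mem_of_mem_erase hs)) (Finset.ne_of_mem_erase hs).symm
  rwa [Finset.insert_erase hh] at h1

theorem length_flagList (S : Finset (Fin n)) : (A.flagList S).length = S.card := by
  have h : ∀ l, (A.tailFlats l).length = l.length := by
    intro l
    induction l with
    | nil => rfl
    | cons i l ih => simp [tailFlats, ih]
  rw [flagList, h, Finset.length_sort]

theorem tailFlats_getElem (l : List (Fin n)) (p : ℕ) (hp : p < (A.tailFlats l).length) :
    (A.tailFlats l)[p] = A.flat (l.drop p).toFinset := by
  induction l generalizing p with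
  | nil => simp [tailFlats] at hp
  | cons i l ih =>
    cases p with
    | zero => simp [tailFlats]
    | succ p => simp [tailFlats, ih]

/-- The smallest hyperplane through the intersection of a nonempty nbc set is in the set. -/
theorem IsNbcSet.exists_min [FiniteDimensional k V] {A : HyperplaneArrangement k P n}
    {S : Finset (Fin n)} (hS : A.IsNbcSet S) (hne : S.Nonempty) :
    ∃ h ∈ S, ∀ i, A.flat S ≤ A.hyp i → h ≤ i := by
  refine ⟨S.min' hne, S.min'_mem hne, fun i hi => ?_⟩
  obtain ⟨t, ht, hti⟩ := (A.isNbcSet_iff.1 hS).2 S subset_rfl hne i hi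
  exact (S.min'_le t ht).trans hti

open Classical in
/-- The flags of nbc sets are dual to the functionals given by the signed sums over orderings. -/
theorem flagSum_single_flagList [FiniteDimensional k V] (R : Type*) [CommRing R] (p : ℕ) :
    ∀ S T : Finset (Fin n), A.IsNbcSet S → A.IsNbcSet T → S.card = p → T.card = p →
      A.flagSum R p S (Pi.single (A.flagList T) 1) = if S = T then 1 else 0 := by
  induction p with
  | zero =>
    intro S T _ _ hS hT
    rw [Finset.card_eq_zero] at hS hT
    subst hS hT
    simp [flagSum_zero, flagList_empty]
  | succ p ih =>
    intro S T hS hT hSc hTc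
    obtain ⟨t, ht, htmin⟩ := hT.exists_min (Finset.card_pos.1 (by omega))
    obtain ⟨s, hs, hsmin⟩ := hS.exists_min (Finset.card_pos.1 (by omega))
    rw [flagSum_succ, A.flagList_of_mem ht fun x hx => htmin x (A.flat_le_hyp hx)]
    by_cases hST : A.flat S = A.flat T
    -- The least label of an nbc set is determined by its flat. Hence `S` and `T` share it, and only
    -- the term removing it, whose sign is 1, can match `T.erase s`.
    · have hst : s = t := le_antisymm (hsmin t (hST ▸ A.flat_le_hyp ht))
        (htmin s (hST ▸ A.flat_le_hyp hs))
      subst hst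
      have hval : ∀ j ∈ S, A.flagSum R p (S.erase j)
          (fun l => (Pi.single (A.flat T :: A.flagList (T.erase s)) (1 : R) : List _ → R)
            (A.flat S :: l)) = if S.erase j = T.erase s then 1 else 0 := by
        intro j hj
        rw [← ih (S.erase j) (T.erase s) (hS.subset (Finset.erase_subset _ _))
          (hT.subset (Finset.erase_subset _ _)) (by rw [Finset.card_erase_of_mem hj, hSc]; rfl)
          (by rw [Finset.card_erase_of_mem ht, hTc]; rfl)]
        congr 1
        funext l
        simp [Pi.single_apply, hST]
      rw [Finset.sum_congr rfl fun j hj => by rw [hval j hj], Finset.sum_eq_single s]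
      · rw [faceSign_eq_one R fun x hx => hsmin x (A.flat_le_hyp hx), one_mul]
        congr 1
        refine propext ⟨fun h => ?_, fun h => by rw [h]⟩
        rw [← Finset.insert_erase hs, h, Finset.insert_erase ht]
      · intro j hj hne
        rw [if_neg, mul_zero]
        intro h
        have : s ∈ T.erase s := by
          rw [← h]
          simp [hs, hne.symm]
        simp at this
      · intro h
        exact absurd hs h
    · rw [if_neg fun h => hST (congrArg A.flat h)]
      refine Finset.sum_eq_zero fun j _ => ?_
      have : (fun l => (Pi.single (A.flat T :: A.flagList (T.erase t)) (1 : R) : List _ → R)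
            (A.flat S :: l)) = 0 := by
        funext l
        exact Pi.single_eq_of_ne (by simp [hST]) _
      rw [this, map_zero, mul_zero]

end FlagList

/-! ### Reduction of complete flags to flags of nbc sets -/

section CompleteFlag

/-- A list of flats of codimensions `p, …, 1`, each contained in the next one. -/
def IsCompleteFlag : List (AffineSubspace k P) → Prop
  | [] => True
  | X :: l => X ≠ ⊥ ∧ (∃ I, X = A.flat I) ∧ X.codim = l.length + 1 ∧ X ≤ l.headD ⊤ ∧
      IsCompleteFlag l

theorem IsCompleteFlag.of_append {A : HyperplaneArrangement k P n}
    {l₁ l₂ : List (AffineSubspace k P)} (h : A.IsCompleteFlag (l₁ ++ l₂)) :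
    A.IsCompleteFlag l₂ := by
  induction l₁ with
  | nil => exact h
  | cons X l ih => exact ih h.2.2.2.2

theorem IsCompleteFlag.codim_headD {A : HyperplaneArrangement k P n}
    {l : List (AffineSubspace k P)} (h : A.IsCompleteFlag l) :
    (l.headD ⊤).codim = l.length := by
  cases l with
  | nil => exact codim_top
  | cons X l => exact h.2.2.1

/-- The next flat is cut properly by the hyperplane, so its codimension rises by at least one, which
is already that of `X`. The default `⊤` stands for the flat after the last one. -/
theorem IsCompleteFlag.eq_inf_hyp [FiniteDimensional k V] {A : HyperplaneArrangement k P n}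
    {X : AffineSubspace k P} {l : List (AffineSubspace k P)} (h : A.IsCompleteFlag (X :: l))
    {i : Fin n} (hX : X ≤ A.hyp i) (hl : ¬ l.headD ⊤ ≤ A.hyp i) : X = A.hyp i ⊓ l.headD ⊤ := by
  have hle : X ≤ A.hyp i ⊓ l.headD ⊤ := le_inf hX h.2.2.2.1
  refine eq_of_le_of_codim_le h.1 hle ?_
  have h1 := codim_lt (fun h0 => h.1 (le_bot_iff.1 (h0 ▸ hle))) (inf_lt_right.2 hl)
  rw [h.2.2.2.2.codim_headD] at h1
  rw [h.2.2.1]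
  exact h1

/-- A subset containing `h` is witnessed by `h` itself; any other subset is one of `B`. -/
theorem IsNbcSet.insert_min [FiniteDimensional k V] {A : HyperplaneArrangement k P n}
    {B : Finset (Fin n)} {h : Fin n} (hB : A.IsNbcSet B) (hne : A.flat (insert h B) ≠ ⊥)
    (hmin : ∀ i, A.flat (insert h B) ≤ A.hyp i → h ≤ i) : A.IsNbcSet (insert h B) := by
  refine A.isNbcSet_iff.2 ⟨hne, fun T hT hTne i hi => ?_⟩
  by_cases hhT : h ∈ T
  · exact ⟨h, hhT, hmin i ((A.flat_anti hT).trans hi)⟩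
  · exact (A.isNbcSet_iff.1 hB).2 T ((Finset.subset_insert_iff_of_notMem hhT).1 hT) hTne i hi

/-- The value on complete flags of a function which satisfies the relations of flags is a
combination of its values on the flags of nbc sets. -/
theorem mem_span_flagList [FiniteDimensional k V] {R N : Type*} [CommRing R] [AddCommGroup N]
    [Module R N] (s : Finset (AffineSubspace k P)) (l : List (AffineSubspace k P)) :
    A.IsCompleteFlag l → ∀ z : List (AffineSubspace k P) → N,
      (∀ m, ¬ A.IsCompleteFlag m → z m = 0) → (∀ I, A.flat I ∈ s) →
      (∀ l₁ l₂, l₁ ≠ [] → ∑ Y ∈ s, z (l₁ ++ Y :: l₂) = 0) →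
      z l ∈ Submodule.span R
        {y | ∃ B, A.IsNbcSet B ∧ A.flat B = l.headD ⊤ ∧ y = z (A.flagList B)} := by
  classical
  induction hp : l.length generalizing l with
  | zero =>
    intro _ z _ _ _
    rw [List.length_eq_zero_iff] at hp
    subst hp
    exact Submodule.subset_span ⟨∅, A.isNbcSet_empty, A.flat_empty, by rw [flagList_empty]⟩
  | succ p ih =>
    intro hl z hz hs hrel
    obtain ⟨X, l, rfl⟩ := List.exists_cons_of_ne_nil (l := l) (by rintro rfl; simp at hp)
    simp only [List.headD_cons]
    set K := Submodule.span R
      {y | ∃ B, A.IsNbcSet B ∧ A.flat B = X ∧ y = z (A.flagList B)}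
    obtain ⟨I, hI⟩ := hl.2.1
    have hIne : I.Nonempty := by
      rw [Finset.nonempty_iff_ne_empty]
      rintro rfl
      have := hl.2.2.1
      rw [hI, flat_empty, codim_top] at this
      omega
    obtain ⟨h, hXh, hmin⟩ : ∃ h, X ≤ A.hyp h ∧ ∀ i, X ≤ A.hyp i → h ≤ i := by
      obtain ⟨h, -, hh⟩ := exists_minimal_le_of_wellFoundedLT (fun i => X ≤ A.hyp i)
        hIne.choose (hI ▸ A.flat_le_hyp hIne.choose_spec)
      exact ⟨h, hh.prop, fun i hi => not_lt.1 fun hlt => hlt.not_ge (hh.2 hi hlt.le)⟩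
    -- Flags `l₁ ++ Z :: l₂` starting with `X`, with `Z` the last element contained in `hyp h`.
    have key : ∀ (l₁ : List (AffineSubspace k P)) (Z : AffineSubspace k P)
        (l₂ : List (AffineSubspace k P)), (l₁ ++ Z :: l₂).length = p + 1 →
        (l₁ ++ Z :: l₂).headD ⊤ = X →
        A.IsCompleteFlag (l₁ ++ Z :: l₂) → Z ≤ A.hyp h → ¬ l₂.headD ⊤ ≤ A.hyp h →
        z (l₁ ++ Z :: l₂) ∈ K := by
      intro l₁
      induction l₁ using List.reverseRecOn with
      | nil =>
        intro Z l₂ hlen hX hfl hZ hl₂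
        simp only [List.nil_append, List.headD_cons, List.length_cons] at hX hlen hfl ⊢
        subst hX
        -- Fixing `Z` as first entry preserves the relations, so the tail reduces to nbc sets `B`
        -- with the same head as `l₂`; adding `h`, the least hyperplane through `Z`, gives nbc sets
        -- with flat `Z`.
        have h1 := ih l₂ (by omega) hfl.2.2.2.2 (fun m => z (Z :: m))
          (fun m hm => hz _ fun h' => hm h'.2.2.2.2) hs
          (fun m₁ m₂ _ => hrel (Z :: m₁) m₂ (by simp))
        refine Submodule.span_mono ?_ h1
        rintro y ⟨B, hB, hBX, rfl⟩
        have hZB : A.flat (insert h B) = Z := by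
          rw [flat_insert, hBX, ← hfl.eq_inf_hyp hZ hl₂]
        refine ⟨insert h B, hB.insert_min (hZB ▸ hfl.1) (hZB ▸ hmin), hZB, ?_⟩
        rw [flagList_insert, hZB]
        intro b hb
        refine lt_of_le_of_ne (hmin b ?_) ?_
        · rw [← hZB]
          exact A.flat_le_hyp (Finset.mem_insert_of_mem hb)
        · rintro rfl
          exact hl₂ (hBX ▸ A.flat_le_hyp hb)
      | append_singleton l₁ Z' ih' =>
        intro Z l₂ hlen hX hfl hZ hl₂
        have hZs : Z ∈ s := by
          obtain ⟨J, hJ⟩ := (hfl.of_append).2.1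
          exact hJ ▸ hs J
        -- Let `Z` vary. Another flat `Y` inside `A.hyp h` would equal `Z`, both being the section
        -- of the next flat by that hyperplane; so for every other `Y` the last element contained in
        -- it is `Z'`, one place closer to the front.
        have h1 := hrel (l₁ ++ [Z']) l₂ (by simp)
        rw [← Finset.add_sum_erase _ _ hZs] at h1
        rw [eq_neg_of_add_eq_zero_left h1]
        refine neg_mem (sum_mem fun Y hY => ?_)
        by_cases hYfl : A.IsCompleteFlag (l₁ ++ [Z'] ++ Y :: l₂)
        swap
        · rw [hz _ hYfl]
          exact zero_mem _
        have hYh : ¬ Y ≤ A.hyp h := by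
          intro hYh
          refine Finset.ne_of_mem_erase hY ?_
          rw [hYfl.of_append.eq_inf_hyp hYh hl₂, hfl.of_append.eq_inf_hyp hZ hl₂]
        have hassoc : ∀ W, l₁ ++ [Z'] ++ W :: l₂ = l₁ ++ Z' :: (W :: l₂) := by simp
        have hZ'Z : Z' ≤ Z := by
          rw [hassoc] at hfl
          simpa using (hfl.of_append).2.2.2.1
        rw [hassoc] at hYfl ⊢
        refine ih' Z' (Y :: l₂) ?_ ?_ hYfl (hZ'Z.trans hZ) (by simpa using hYh)
        · simpa using hlen
        · rw [← hX]
          cases l₁ <;> simp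
    have hsplit : ∀ m, A.IsCompleteFlag m → m.headD ⊤ ≤ A.hyp h →
        ∃ l₁ Z l₂, m = l₁ ++ Z :: l₂ ∧ Z ≤ A.hyp h ∧ ¬ l₂.headD ⊤ ≤ A.hyp h := by
      intro m
      induction m with
      | nil => exact fun _ h' => absurd h' (A.not_top_le_hyp h)
      | cons Y m ihm =>
        intro hm hY
        by_cases hmh : m.headD ⊤ ≤ A.hyp h
        · obtain ⟨l₁, Z, l₂, rfl, hZ, hl₂⟩ := ihm hm.2.2.2.2 hmh
          exact ⟨Y :: l₁, Z, l₂, rfl, hZ, hl₂⟩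
        · exact ⟨[], Y, m, rfl, hY, hmh⟩
    obtain ⟨l₁, Z, l₂, heq, hZ, hl₂⟩ := hsplit (X :: l) hl hXh
    rw [heq] at hp hl ⊢
    exact key l₁ Z l₂ hp (by rw [← heq]; rfl) hl hZ hl₂

end CompleteFlag

/-! ### Simplices of the Folkman complex as lists of subspaces -/

section FlagToList

variable {p : ℕ}

/-- A vertex of the Folkman complex, as an affine subspace. -/
def toSubspace (X : A.FolkmanVertex) : AffineSubspace k P := X.1.1

theorem toSubspace_injective : Function.Injective A.toSubspace := fun _ _ h =>
  Subtype.ext (Subtype.ext h)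

theorem toSubspace_ne_bot (X : A.FolkmanVertex) : A.toSubspace X ≠ ⊥ := X.1.2.1

theorem toSubspace_ne_top (X : A.FolkmanVertex) : A.toSubspace X ≠ ⊤ := X.2

theorem exists_toSubspace_eq_flat (X : A.FolkmanVertex) : ∃ I, A.toSubspace X = A.flat I :=
  X.1.2.2

theorem toSubspace_lt_of_lt {X Y : A.FolkmanVertex} (h : Y < X) :
    A.toSubspace X < A.toSubspace Y := h

theorem face_apply {Q : Type*} [PartialOrder Q] (x : PosetFlag Q (p + 1)) (i : Fin (p + 1))
    (j : Fin p) : (x.face i).1 j = x.1 (i.succAbove j) := rfl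

/-- The list of affine subspaces of a flag, in increasing order of subspaces. -/
def flagToList (x : PosetFlag A.FolkmanVertex p) : List (AffineSubspace k P) :=
  List.ofFn fun i => A.toSubspace (x.1 i)

theorem length_flagToList (x : PosetFlag A.FolkmanVertex p) : (A.flagToList x).length = p :=
  List.length_ofFn

theorem getElem_flagToList (x : PosetFlag A.FolkmanVertex p) (i : ℕ)
    (hi : i < (A.flagToList x).length) :
    (A.flagToList x)[i] = A.toSubspace (x.1 ⟨i, A.length_flagToList x ▸ hi⟩) :=
  List.getElem_ofFn _

theorem flagToList_injective :
    Function.Injective (A.flagToList : PosetFlag A.FolkmanVertex p → _) := fun _ _ h =>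
  Subtype.ext (funext fun i => A.toSubspace_injective (congrFun (List.ofFn_injective h) i))

theorem eraseIdx_flagToList (x : PosetFlag A.FolkmanVertex (p + 1)) (i : Fin (p + 1)) :
    (A.flagToList x).eraseIdx i = A.flagToList (x.face i) := by
  refine List.ext_getElem ?_ fun j h1 h2 => ?_
  · rw [List.length_eraseIdx_of_lt (by rw [length_flagToList]; exact i.2), length_flagToList,
      length_flagToList]
    rfl
  · have hj : j < p := A.length_flagToList (x.face i) ▸ h2
    rw [List.getElem_eraseIdx, getElem_flagToList A (x.face i), face_apply]
    split_ifs with h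
    · rw [getElem_flagToList, Fin.succAbove_of_castSucc_lt i ⟨j, hj⟩ h]
      rfl
    · rw [getElem_flagToList, Fin.succAbove_of_le_castSucc i ⟨j, hj⟩ (not_lt.1 h)]
      rfl

theorem pairwise_flagToList (x : PosetFlag A.FolkmanVertex p) :
    (A.flagToList x).Pairwise (· < ·) := by
  rw [flagToList, List.pairwise_ofFn]
  exact fun i j hij => A.toSubspace_lt_of_lt (x.2 hij)

theorem mem_flagToList {x : PosetFlag A.FolkmanVertex p} {X : AffineSubspace k P}
    (hX : X ∈ A.flagToList x) : X ≠ ⊥ ∧ X ≠ ⊤ ∧ ∃ I, X = A.flat I := by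
  obtain ⟨i, rfl⟩ := (List.mem_ofFn' _ _).1 hX
  exact ⟨A.toSubspace_ne_bot _, A.toSubspace_ne_top _, A.exists_toSubspace_eq_flat _⟩

theorem exists_flagToList_eq {l : List (AffineSubspace k P)} (hp : l.length = p)
    (hl : l.Pairwise (· < ·)) (hmem : ∀ X ∈ l, X ≠ ⊥ ∧ X ≠ ⊤ ∧ ∃ I, X = A.flat I) :
    ∃ x : PosetFlag A.FolkmanVertex p, A.flagToList x = l := by
  subst hp
  refine ⟨⟨fun i => ⟨⟨l.get i, (hmem _ (l.get_mem i)).1, (hmem _ (l.get_mem i)).2.2⟩,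
    (hmem _ (l.get_mem i)).2.1⟩, fun i j hij => ?_⟩, List.ofFn_get l⟩
  exact (show l.get i < l.get j from List.pairwise_iff_get.1 hl i j hij)

theorem flagToList_xi [FiniteDimensional k V] {B : Finset (Fin n)} (hB : A.IsBase B) :
    A.flagToList (A.xi hB) = A.flagList B := by
  refine List.ext_getElem ?_ fun j h1 h2 => ?_
  · rw [length_flagToList, length_flagList, IsBase.card_eq A hB]
  · rw [getElem_flagToList]
    simp only [flagList, tailFlats_getElem]
    refine congrArg A.flat (?_ : A.lastLabels hB _ = _)
    ext i
    simp only [lastLabels, Finset.mem_map, Finset.mem_Ici, List.mem_toFinset,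
      RelEmbedding.coe_toEmbedding, Finset.orderEmbOfFin_apply, List.mem_drop_iff_getElem]
    constructor
    · rintro ⟨q, hq, rfl⟩
      have hq' : j ≤ (q : ℕ) := hq
      refine ⟨q - j, ?_, ?_⟩
      · rw [Finset.length_sort, IsBase.card_eq A hB]
        omega
      · congr 1
        omega
    · rintro ⟨m, hm, rfl⟩
      have hm' : m + j < A.rank := by
        rwa [Finset.length_sort, IsBase.card_eq A hB] at hm
      refine ⟨⟨j + m, by omega⟩, ?_, rfl⟩
      simp [Fin.le_def]

end FlagToList

/-! ### Pairing of cycles of independent sets with cochains -/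

section Pairing

variable {R : Type*} [CommRing R]

/-- `flagSum` only depends on the values on flags. -/
theorem flagSum_congr [FiniteDimensional k V] (p : ℕ) :
    ∀ (S : Finset (Fin n)), A.IsIndependent S → S.card = p →
      ∀ f g : List (AffineSubspace k P) → R,
      (∀ l : List (AffineSubspace k P), l.length = p → l.Pairwise (· < ·) →
        (∀ X ∈ l, X ≠ ⊥ ∧ X ≠ ⊤ ∧ ∃ I, X = A.flat I) → (∀ X ∈ l, A.flat S ≤ X) → f l = g l) →
      A.flagSum R p S f = A.flagSum R p S g := by
  induction p with
  | zero =>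
    intro S _ _ f g h
    rw [flagSum_zero, flagSum_zero, h [] rfl List.Pairwise.nil (by simp) (by simp)]
  | succ p ih =>
    intro S hS hc f g h
    rw [flagSum_succ, flagSum_succ]
    refine Finset.sum_congr rfl fun j hj => ?_
    congr 1
    have hSj : A.IsIndependent (S.erase j) := hS.subset A (Finset.erase_subset _ _)
    have hcj : (S.erase j).card = p := by rw [Finset.card_erase_of_mem hj, hc]; rfl
    have hle : A.flat S ≤ A.flat (S.erase j) := A.flat_anti (Finset.erase_subset _ _)
    have hlt : A.flat S < A.flat (S.erase j) := by
      refine lt_of_le_of_ne hle fun heq => ?_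
      have h1 := hS.codim_eq
      rw [heq, hSj.codim_eq] at h1
      omega
    refine ih _ hSj hcj _ _ fun l hl hpw hmem hSl => ?_
    refine h _ (by simp [hl]) ?_ ?_ ?_
    · exact List.pairwise_cons.2 ⟨fun X hX => hlt.trans_le (hSl X hX), hpw⟩
    · rintro X (_ | ⟨_, hX⟩)
      · exact ⟨hS.1, hlt.ne_top, S, rfl⟩
      · exact hmem X hX
    · rintro X (_ | ⟨_, hX⟩)
      · exact le_rfl
      · exact hle.trans (hSl X hX)

theorem flagSum_congr_flagToList [FiniteDimensional k V] {p : ℕ} {S : Finset (Fin n)}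
    (hS : A.IsIndependent S) (hc : S.card = p) {f g : List (AffineSubspace k P) → R}
    (h : ∀ x : PosetFlag A.FolkmanVertex p, f (A.flagToList x) = g (A.flagToList x)) :
    A.flagSum R p S f = A.flagSum R p S g := by
  refine A.flagSum_congr p S hS hc f g fun l hl hpw hmem _ => ?_
  obtain ⟨x, rfl⟩ := A.exists_flagToList_eq hl hpw hmem
  exact h x

/-- A cochain, as a function on lists vanishing on lists which are not flags. -/
noncomputable def extendCochain {p : ℕ} (f : PosetFlag.Cochain A.FolkmanVertex R p) :
    List (AffineSubspace k P) → R :=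
  Function.extend A.flagToList f 0

theorem extendCochain_apply {p : ℕ} (f : PosetFlag.Cochain A.FolkmanVertex R p)
    (x : PosetFlag A.FolkmanVertex p) : A.extendCochain f (A.flagToList x) = f x :=
  A.flagToList_injective.extend_apply f 0 x

theorem extendCochain_coboundary {p : ℕ} (g : PosetFlag.Cochain A.FolkmanVertex R p)
    (x : PosetFlag A.FolkmanVertex (p + 1)) :
    A.extendCochain (PosetFlag.coboundary A.FolkmanVertex R p g) (A.flagToList x) =
      listCoboundary (A.flagToList x) (A.extendCochain g) := by
  rw [extendCochain_apply, listCoboundary_eq_sum, length_flagToList, Finset.sum_range]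
  change ∑ i : Fin (p + 1), (-1 : R) ^ (i : ℕ) * g (x.face i) = _
  refine Finset.sum_congr rfl fun i _ => ?_
  rw [eraseIdx_flagToList, extendCochain_apply]

/-- Cycles of the complex of independent sets pair to zero with coboundaries. -/
theorem sum_mul_flagSum_eq_zero [FiniteDimensional k V] {p : ℕ} {z : Finset (Fin n) → R}
    (hz : ∀ D, z D ≠ 0 → A.IsIndependent D ∧ D.card = p) (hcyc : simplexBoundary R z = 0)
    {f : PosetFlag.Cochain A.FolkmanVertex R p}
    (hf : f ∈ PosetFlag.coboundaries A.FolkmanVertex R p) :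
    ∑ D, z D * A.flagSum R p D (A.extendCochain f) = 0 := by
  cases p with
  | zero =>
    rw [show f = 0 from (Submodule.mem_bot R).1 hf]
    refine Finset.sum_eq_zero fun D _ => ?_
    have : A.extendCochain (0 : PosetFlag.Cochain A.FolkmanVertex R 0) = 0 := by
      funext l
      by_cases hl : ∃ x : PosetFlag A.FolkmanVertex 0, A.flagToList x = l
      · obtain ⟨x, rfl⟩ := hl
        rw [extendCochain_apply]
        rfl
      · exact Function.extend_apply' _ _ _ hl
    rw [this, map_zero, mul_zero]
  | succ p =>
    obtain ⟨g, rfl⟩ := LinearMap.mem_range.1 hf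
    -- `flagSum` carries the coboundary of `g` to a coboundary on sets of labels, whose adjoint is
    -- the boundary, and that annihilates `z`.
    have h : ∀ D : Finset (Fin n), z D * A.flagSum R (p + 1) D
          (A.extendCochain (PosetFlag.coboundary A.FolkmanVertex R p g)) =
        z D * ∑ j ∈ D, faceSign R D j * A.flagSum R p (D.erase j) (A.extendCochain g) := by
      intro D
      by_cases hD : z D = 0
      · rw [hD, zero_mul, zero_mul]
      · rw [← flagSum_listCoboundary, A.flagSum_congr_flagToList (hz D hD).1 (hz D hD).2
          (g := fun l => listCoboundary l (A.extendCochain g)) (A.extendCochain_coboundary g)]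
    rw [Finset.sum_congr rfl fun D _ => h D,
      sum_mul_coboundary z fun S => A.flagSum R p S (A.extendCochain g), hcyc]
    simp

end Pairing

/-! ### Coboundaries as relations between maximal flags -/

section Relations

theorem codim_flag [FiniteDimensional k V] {p : ℕ} (hp : ∀ I, A.flat I ≠ ⊥ → (A.flat I).codim ≤ p)
    (x : PosetFlag A.FolkmanVertex p) (i : Fin p) : (A.toSubspace (x.1 i)).codim = p - i := by
  have hle : ∀ j, (A.toSubspace (x.1 j)).codim ≤ p := fun j => by
    obtain ⟨I, hI⟩ := A.exists_toSubspace_eq_flat (x.1 j)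
    rw [hI]
    exact hp I (hI ▸ A.toSubspace_ne_bot _)
  have hpos : ∀ j, 0 < (A.toSubspace (x.1 j)).codim := fun j =>
    Nat.zero_lt_of_lt (codim_lt (A.toSubspace_ne_bot _) (lt_top_iff_ne_top.2 (A.toSubspace_ne_top (x.1 j))))
  -- The codimensions are `p` strictly decreasing numbers between 1 and `p`; a strictly monotone
  -- self-map of `Fin p` is the identity.
  have hmono : StrictMono fun j : Fin p =>
      (⟨p - (A.toSubspace (x.1 j)).codim, by have := hle j; have := hpos j; omega⟩ : Fin p) := by
    intro j j' hjj'
    have h1 : (A.toSubspace (x.1 j')).codim < (A.toSubspace (x.1 j)).codim := 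
      codim_lt (A.toSubspace_ne_bot _) (A.toSubspace_lt_of_lt (x.2 hjj'))
    have := hle j
    simp only [Fin.mk_lt_mk]
    omega
  have h := le_antisymm hmono.apply_le (hmono.le_apply (x := i))
  have h1 := congrArg Fin.val h
  have := hle i
  simp only at h1
  omega

theorem isCompleteFlag_of_pairwise (l : List (AffineSubspace k P)) (hl : l.Pairwise (· < ·))
    (hmem : ∀ X ∈ l, X ≠ ⊥ ∧ ∃ I, X = A.flat I)
    (hc : ∀ i (hi : i < l.length), l[i].codim = l.length - i) : A.IsCompleteFlag l := by
  induction l with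
  | nil => trivial
  | cons X l ih =>
    refine ⟨(hmem X (by simp)).1, (hmem X (by simp)).2, hc 0 (by simp), ?_,
      ih hl.of_cons (fun Y hY => hmem Y (by simp [hY])) fun i hi => ?_⟩
    · cases l with
      | nil => exact le_top
      | cons Y l => exact ((List.pairwise_cons.1 hl).1 Y (by simp)).le
    · have h := hc (i + 1) (by simpa using hi)
      exact h.trans (Nat.add_sub_add_right _ _ _)

theorem isCompleteFlag_flagToList [FiniteDimensional k V]
    (x : PosetFlag A.FolkmanVertex A.rank) : A.IsCompleteFlag (A.flagToList x) := by
  refine A.isCompleteFlag_of_pairwise _ (A.pairwise_flagToList x)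
    (fun X hX => ⟨(A.mem_flagToList hX).1, (A.mem_flagToList hX).2.2⟩) fun i hi => ?_
  rw [getElem_flagToList, A.codim_flag (fun I hI => A.codim_le_rank hI)]
  simp only [length_flagToList]

theorem _root_.List.eq_append_cons_iff {α : Type*} {l l₁ l₂ : List α} {a : α} :
    l = l₁ ++ a :: l₂ ↔
      ∃ h : l₁.length < l.length, l[l₁.length] = a ∧ l.eraseIdx l₁.length = l₁ ++ l₂ := by
  constructor
  · rintro rfl
    refine ⟨by simp, by simp, ?_⟩
    rw [List.eraseIdx_append_of_length_le le_rfl]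
    simp
  · rintro ⟨h, rfl, h'⟩
    rw [List.eraseIdx_eq_take_drop_succ] at h'
    have h1 := List.append_inj h' (by simp [h.le])
    conv_lhs => rw [← List.take_append_drop l₁.length l, List.drop_eq_getElem_cons h, h1.1, h1.2]

open Classical in
/-- The set of all intersections of hyperplanes of the arrangement. -/
noncomputable def flats : Finset (AffineSubspace k P) := Finset.univ.image A.flat

theorem flat_mem_flats (I : Finset (Fin n)) : A.flat I ∈ A.flats := by
  simp [flats]

open Classical in
/-- The sum of all maximal flags with one place left free is a coboundary. -/
theorem sum_flats_mem_coboundaries [FiniteDimensional k V] (R : Type*) [CommRing R] {p : ℕ}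
    (hp : ∀ I, A.flat I ≠ ⊥ → (A.flat I).codim ≤ p) (l₁ l₂ : List (AffineSubspace k P)) :
    (fun x : PosetFlag A.FolkmanVertex p =>
      ∑ Y ∈ A.flats, if A.flagToList x = l₁ ++ Y :: l₂ then (1 : R) else 0) ∈
      PosetFlag.coboundaries A.FolkmanVertex R p := by
  by_cases hex : ∃ (x : PosetFlag A.FolkmanVertex p) (Y : AffineSubspace k P),
      A.flagToList x = l₁ ++ Y :: l₂
  swap
  · have : (fun x : PosetFlag A.FolkmanVertex p =>
        ∑ Y ∈ A.flats, if A.flagToList x = l₁ ++ Y :: l₂ then (1 : R) else 0) = 0 := by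
      funext x
      exact Finset.sum_eq_zero fun Y _ => if_neg fun h => hex ⟨x, Y, h⟩
    rw [this]
    exact zero_mem _
  obtain ⟨x₀, Y₀, hx₀⟩ := hex
  cases p with
  | zero =>
    have h := A.length_flagToList x₀
    rw [hx₀] at h
    simp at h
  | succ p =>
    obtain ⟨hq, -, herase⟩ := List.eq_append_cons_iff.1 hx₀
    rw [length_flagToList] at hq
    set q : Fin (p + 1) := ⟨l₁.length, hq⟩ with hqdef
    rw [show l₁.length = (q : ℕ) from rfl, eraseIdx_flagToList] at herase
    -- The coboundary of the dual of the face sums over all ways of refilling the gap; the factor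
    -- `(-1) ^ q` cancels the incidence sign.
    refine LinearMap.mem_range.2
      ⟨(-1 : R) ^ (q : ℕ) • PosetFlag.dual R (x₀.face q), funext fun x => ?_⟩
    -- The codimension missing from a face of a maximal flag reveals which place was deleted.
    have hother : ∀ i : Fin (p + 1), i ≠ q → x.face i ≠ x₀.face q := by
      intro i hi h
      rcases lt_or_gt_of_ne hi with hlt | hlt
      · have hne : (i : ℕ) < p := by
          have := q.2
          have : (i : ℕ) < q := hlt
          omega
        have h1 := congrFun (congrArg Subtype.val h) ⟨i, hne⟩
        rw [face_apply, face_apply] at h1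
        rw [Fin.succAbove_of_le_castSucc i ⟨i, hne⟩ (Fin.le_def.2 le_rfl),
          Fin.succAbove_of_castSucc_lt q ⟨i, hne⟩ hlt] at h1
        have h2 := congrArg (fun X => (A.toSubspace X).codim) h1
        simp only [A.codim_flag hp, Fin.val_succ, Fin.val_castSucc] at h2
        omega
      · have hne : (q : ℕ) < p := by
          have := i.2
          have : (q : ℕ) < i := hlt
          omega
        have h1 := congrFun (congrArg Subtype.val h) ⟨q, hne⟩
        rw [face_apply, face_apply] at h1
        rw [Fin.succAbove_of_castSucc_lt i ⟨q, hne⟩ hlt,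
          Fin.succAbove_of_le_castSucc q ⟨q, hne⟩ (Fin.le_def.2 le_rfl)] at h1
        have h2 := congrArg (fun X => (A.toSubspace X).codim) h1
        simp only [A.codim_flag hp, Fin.val_succ, Fin.val_castSucc] at h2
        omega
    have hlhs : PosetFlag.coboundary A.FolkmanVertex R p
        ((-1 : R) ^ (q : ℕ) • PosetFlag.dual R (x₀.face q)) x =
        if x.face q = x₀.face q then 1 else 0 := by
      change ∑ i : Fin (p + 1), (-1 : R) ^ (i : ℕ) * ((-1 : R) ^ (q : ℕ) *
        (if x.face i = x₀.face q then 1 else 0)) = _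
      rw [Finset.sum_eq_single q]
      · rw [← mul_assoc, ← mul_pow]
        simp
      · intro i _ hi
        rw [if_neg (hother i hi), mul_zero, mul_zero]
      · simp
    rw [hlhs, Finset.sum_eq_single (A.toSubspace (x.1 q))]
    · congr 1
      rw [eq_iff_iff, List.eq_append_cons_iff, ← A.flagToList_injective.eq_iff, herase,
        ← eraseIdx_flagToList]
      have hlen : l₁.length < (A.flagToList x).length := by rwa [length_flagToList]
      constructor
      · intro h
        exact ⟨hlen, by rw [getElem_flagToList], h⟩
      · rintro ⟨-, -, h⟩
        exact h
    · intro Y _ hY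
      refine if_neg fun h => hY ?_
      obtain ⟨h1, h2, -⟩ := List.eq_append_cons_iff.1 h
      rw [← h2, getElem_flagToList]
    · intro h
      obtain ⟨I, hI⟩ := A.exists_toSubspace_eq_flat (x.1 q)
      exact absurd (hI ▸ A.flat_mem_flats I) h

end Relations

/-! ### The top cohomology: expansion, spanning and independence -/

section Cohomology

variable [FiniteDimensional k V] (R : Type*) [CommRing R]

/-- The linear map taking an `(r - 1)`-cochain to its cohomology class. -/
noncomputable def cohomologyMap :
    PosetFlag.Cochain A.FolkmanVertex R A.rank →ₗ[R] A.FolkmanCohomology R where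
  toFun := A.cohomologyClass
  map_add' _ _ := rfl
  map_smul' _ _ := rfl

variable {R} in
theorem cohomologyMap_eq_zero_iff {f : PosetFlag.Cochain A.FolkmanVertex R A.rank} :
    A.cohomologyMap R f = 0 ↔ f ∈ PosetFlag.coboundaries A.FolkmanVertex R A.rank :=
  Submodule.Quotient.mk_eq_zero _

theorem cohomologyMap_surjective : Function.Surjective (A.cohomologyMap R) := fun m => by
  obtain ⟨⟨f, hf⟩, rfl⟩ := Submodule.Quotient.mk_surjective _ m
  exact ⟨f, rfl⟩

open Classical in
/-- The cohomology class of the cochain dual to a list of flats, which vanishes unless the list is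
a maximal flag. -/
noncomputable def listClass (l : List (AffineSubspace k P)) : A.FolkmanCohomology R :=
  A.cohomologyMap R fun x => if A.flagToList x = l then 1 else 0

theorem listClass_flagToList (x : PosetFlag A.FolkmanVertex A.rank) :
    A.listClass R (A.flagToList x) = A.cohomologyMap R (PosetFlag.dual R x) := by
  classical
  unfold listClass PosetFlag.dual
  refine congrArg (A.cohomologyMap R) (funext fun y => ?_)
  by_cases h : y = x
  · simp [h]
  · rw [if_neg h, if_neg fun h' => h (A.flagToList_injective h')]

theorem listClass_flagList {B : Finset (Fin n)} (hB : A.IsBase B) :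
    A.listClass R (A.flagList B) = A.cohomologyClass (PosetFlag.dual R (A.xi hB)) := by
  rw [← A.flagToList_xi hB, listClass_flagToList]
  rfl

theorem listClass_eq_zero {l : List (AffineSubspace k P)}
    (h : ¬ ∃ x : PosetFlag A.FolkmanVertex A.rank, A.flagToList x = l) :
    A.listClass R l = 0 := by
  unfold listClass
  refine (congrArg (A.cohomologyMap R) (funext fun x => ?_)).trans (map_zero _)
  exact if_neg fun hx => h ⟨x, hx⟩

theorem sum_listClass_eq_zero (l₁ l₂ : List (AffineSubspace k P)) :
    ∑ Y ∈ A.flats, A.listClass R (l₁ ++ Y :: l₂) = 0 := by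
  classical
  unfold listClass
  rw [← map_sum, cohomologyMap_eq_zero_iff]
  convert A.sum_flats_mem_coboundaries R (fun I hI => A.codim_le_rank hI) l₁ l₂ using 1
  funext x
  rw [Finset.sum_apply]

instance : Finite A.IntersectionPoset := by
  refine Finite.of_injective (β := Set.range A.flat) (fun X => ⟨X.1, X.2.2.imp fun I hI => hI.symm⟩)
    fun X Y h => ?_
  exact Subtype.ext (congrArg (fun Z : Set.range A.flat => Z.1) h)

instance (p : ℕ) : Finite (PosetFlag A.FolkmanVertex p) :=
  inferInstanceAs (Finite {x : Fin p → A.FolkmanVertex // StrictAnti x})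

theorem span_listClass_flagToList :
    Submodule.span R (Set.range fun x : PosetFlag A.FolkmanVertex A.rank =>
      A.listClass R (A.flagToList x)) = ⊤ := by
  classical
  have := Fintype.ofFinite (PosetFlag A.FolkmanVertex A.rank)
  refine eq_top_iff.2 fun m _ => ?_
  obtain ⟨f, rfl⟩ := A.cohomologyMap_surjective R m
  have hf : f = ∑ x, f x • PosetFlag.dual R x := by
    funext y
    simp [PosetFlag.dual, Finset.sum_apply]
  rw [hf, map_sum]
  refine sum_mem fun x _ => ?_
  rw [map_smul, ← listClass_flagToList]
  exact Submodule.smul_mem _ _ (Submodule.subset_span ⟨x, rfl⟩)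

open Classical in
/-- The expansion of the class of a flag in terms of the classes of the flags of nbc bases. -/
theorem listClass_eq_sum (l : List (AffineSubspace k P)) :
    A.listClass R l = ∑ B ∈ A.nbcBases,
      A.flagSum R A.rank B (Pi.single l 1) • A.listClass R (A.flagList B) := by
  have hflag : ∀ l, (¬ ∃ x : PosetFlag A.FolkmanVertex A.rank, A.flagToList x = l) →
      ∀ B ∈ A.nbcBases, A.flagSum R A.rank B (Pi.single l 1) = 0 := by
    intro l hl B hB
    rw [mem_nbcBases] at hB
    rw [A.flagSum_congr_flagToList hB.2.isIndependent (IsBase.card_eq A hB.1) (g := 0), map_zero]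
    exact fun x => Pi.single_eq_of_ne (fun h => hl ⟨x, h⟩) _
  by_cases hl : ∃ x : PosetFlag A.FolkmanVertex A.rank, A.flagToList x = l
  swap
  · rw [A.listClass_eq_zero R hl, Finset.sum_eq_zero fun B hB => by rw [hflag l hl B hB, zero_smul]]
  obtain ⟨x, rfl⟩ := hl
  -- Class and coefficients satisfy the same relations, so they are reduced together as a pair. The
  -- pairs for which the expansion holds form a submodule, and duality puts the pairs of the nbc
  -- bases in it.
  let z : List (AffineSubspace k P) → A.FolkmanCohomology R × (A.nbcBases → R) := fun l =>
    (A.listClass R l, fun B => A.flagSum R A.rank B (Pi.single l 1))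
  have hmem := A.mem_span_flagList (R := R) A.flats (A.flagToList x) (A.isCompleteFlag_flagToList x)
    z ?_ A.flat_mem_flats ?_
  · let K : Submodule R (A.FolkmanCohomology R × (A.nbcBases → R)) :=
      LinearMap.eqLocus (LinearMap.fst R _ _)
        (∑ B : A.nbcBases, (LinearMap.toSpanSingleton R _ (A.listClass R (A.flagList B))) ∘ₗ
          LinearMap.proj B ∘ₗ LinearMap.snd R _ _)
    have hK : z (A.flagToList x) ∈ K := by
      refine Submodule.span_le.2 ?_ hmem
      rintro y ⟨B, hB, hBx, rfl⟩
      have hcard : B.card = A.rank := by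
        rw [← hB.isIndependent.codim_eq, hBx, (A.isCompleteFlag_flagToList x).codim_headD,
          length_flagToList]
      have hBase : B ∈ A.nbcBases :=
        A.mem_nbcBases.2 ⟨A.isBase_iff.2 ⟨hB.isIndependent, hcard⟩, hB⟩
      rw [SetLike.mem_coe, LinearMap.mem_eqLocus]
      simp only [z, LinearMap.sum_apply, LinearMap.comp_apply, LinearMap.fst_apply,
        LinearMap.snd_apply, LinearMap.proj_apply, LinearMap.toSpanSingleton_apply]
      rw [Finset.sum_eq_single ⟨B, hBase⟩]
      · rw [A.flagSum_single_flagList R A.rank B B hB hB hcard hcard, if_pos rfl, one_smul]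
      · rintro ⟨D, hD⟩ - hne
        have hD' := A.mem_nbcBases.1 hD
        rw [A.flagSum_single_flagList R A.rank D B hD'.2 hB (IsBase.card_eq A hD'.1) hcard,
          if_neg, zero_smul]
        exact fun h => hne (Subtype.ext h)
      · simp
    rw [LinearMap.mem_eqLocus] at hK
    simp only [z, LinearMap.sum_apply, LinearMap.comp_apply, LinearMap.fst_apply,
        LinearMap.snd_apply, LinearMap.proj_apply, LinearMap.toSpanSingleton_apply] at hK
    rw [hK, Finset.sum_coe_sort A.nbcBases fun B =>
      A.flagSum R A.rank B (Pi.single (A.flagToList x) 1) • A.listClass R (A.flagList B)]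
  · intro m hm
    have hm' : ¬ ∃ x : PosetFlag A.FolkmanVertex A.rank, A.flagToList x = m := by
      rintro ⟨x, rfl⟩
      exact hm (A.isCompleteFlag_flagToList x)
    exact Prod.ext (A.listClass_eq_zero R hm') (funext fun B => hflag m hm' B B.2)
  · intro l₁ l₂ h₁
    refine Prod.ext ?_ (funext fun B => ?_)
    · rw [Prod.fst_sum]
      exact A.sum_listClass_eq_zero R l₁ l₂
    · rw [Prod.snd_sum, Finset.sum_apply]
      simp only [z]
      rw [← map_sum]
      exact A.flagSum_append_free A.flats A.flat_mem_flats A.rank B l₁ l₂ h₁ _ fun l =>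
        Finset.sum_apply _ _ _

/-- The coboundary of a codimension one face of an nbc base. -/
theorem sum_faceSign_listClass {C : Finset (Fin n)} {c : Fin n} (hC : C ∈ A.nbcBases)
    (hc : c ∈ C) :
    ∑ B ∈ A.nbcBases, (∑ j ∈ B, faceSign R B j * if B.erase j = C.erase c then 1 else 0) •
      A.listClass R (A.flagList B) = 0 := by
  classical
  obtain ⟨p, hp⟩ : ∃ p, A.rank = p + 1 := by
    refine Nat.exists_eq_succ_of_ne_zero ?_
    rw [← IsBase.card_eq A (A.mem_nbcBases.1 hC).1]
    exact Finset.card_ne_zero_of_mem hc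
  have herase : ∀ B ∈ A.nbcBases, ∀ j ∈ B, A.IsNbcSet (B.erase j) ∧ (B.erase j).card = p := by
    intro B hB j hj
    rw [mem_nbcBases] at hB
    refine ⟨hB.2.subset (Finset.erase_subset _ _), ?_⟩
    rw [Finset.card_erase_of_mem hj, IsBase.card_eq A hB.1, hp]
    rfl
  -- The relation used is the one with free first place above the flag of the face; each term is
  -- then expanded in nbc bases.
  rw [← A.sum_listClass_eq_zero R [] (A.flagList (C.erase c))]
  simp only [List.nil_append]
  rw [Finset.sum_congr rfl fun Y _ => A.listClass_eq_sum R (Y :: A.flagList (C.erase c)),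
    Finset.sum_comm]
  refine Finset.sum_congr rfl fun B hB => ?_
  rw [← Finset.sum_smul]
  refine congrArg (· • A.listClass R (A.flagList B)) ?_
  rw [hp, A.flagSum_free A.flats A.flat_mem_flats]
  refine Finset.sum_congr rfl fun j hj => ?_
  rw [A.flagSum_single_flagList R p _ _ (herase B hB j hj).1 (herase C hC c hc).1
    (herase B hB j hj).2 (herase C hC c hc).2]

/-- Descending induction in the lexicographic order: a base that fails the βnbc condition at `c` is
rewritten, by the relation of its face opposite to `c`, through lexicographically later bases. -/
theorem listClass_mem_span {C : Finset (Fin n)} (hC : C ∈ A.nbcBases) :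
    A.listClass R (A.flagList C) ∈ Submodule.span R
      (Set.range fun B : {B : Finset (Fin n) // A.IsBetaNbcBase B} =>
        A.listClass R (A.flagList B)) := by
  classical
  have hwf : WellFounded fun B C : Finset (Fin n) => C.lexKey < B.lexKey := by
    have : IsTrans (Finset (Fin n)) fun B C => C.lexKey < B.lexKey :=
      ⟨fun _ _ _ h h' => h'.trans h⟩
    have : Std.Irrefl fun B C : Finset (Fin n) => C.lexKey < B.lexKey := ⟨fun _ => lt_irrefl _⟩
    exact Finite.wellFounded_of_trans_of_irrefl _
  induction C using hwf.induction with | _ C ih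
  have hC' := A.mem_nbcBases.1 hC
  by_cases hβ : A.IsBetaNbcBase C
  · exact Submodule.subset_span ⟨⟨C, hβ⟩, rfl⟩
  obtain ⟨c, hc, hnc⟩ : ∃ c ∈ C, ∀ h < c, ¬ A.IsBase (insert h (C.erase c)) := by
    by_contra! hcon
    exact hβ (A.isBetaNbcBase_iff.2 ⟨hC'.1, hC'.2, hcon⟩)
  have hrel := A.sum_faceSign_listClass R hC hc
  rw [← Finset.add_sum_erase _ _ hC] at hrel
  have hcoef : ∑ j ∈ C, (faceSign R C j * if C.erase j = C.erase c then 1 else 0) =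
      faceSign R C c := by
    rw [Finset.sum_eq_single c]
    · simp
    · intro j hj hne
      rw [if_neg, mul_zero]
      intro h
      have : j ∈ C.erase j := h ▸ Finset.mem_erase.2 ⟨hne, hj⟩
      simp at this
    · exact fun h => absurd hc h
  rw [hcoef] at hrel
  have hmem : faceSign R C c • A.listClass R (A.flagList C) ∈ Submodule.span R
      (Set.range fun B : {B : Finset (Fin n) // A.IsBetaNbcBase B} =>
        A.listClass R (A.flagList B)) := by
    rw [eq_neg_of_add_eq_zero_left hrel]
    refine neg_mem (sum_mem fun B hB => ?_)
    obtain ⟨hBC, hB⟩ := Finset.mem_erase.1 hB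
    by_cases hex : ∃ j ∈ B, B.erase j = C.erase c
    · obtain ⟨j, hj, hjc⟩ := hex
      refine Submodule.smul_mem _ _ (ih B ?_ hB)
      have hBj : B = insert j (C.erase c) := by rw [← hjc, Finset.insert_erase hj]
      have hjne : j ≠ c := by
        rintro rfl
        exact hBC (by rw [hBj, Finset.insert_erase hc])
      have hjC : j ∉ C := A.notMem_of_isBase_exchange hC'.1 hc hjne
        (hBj ▸ (A.mem_nbcBases.1 hB).1)
      -- `c` has no smaller replacement, so every other nbc base through this face replaces it by a
      -- larger label.
      have hcj : c < j := lt_of_le_of_ne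
        (not_lt.1 fun hlt => hnc j hlt (hBj ▸ (A.mem_nbcBases.1 hB).1)) hjne.symm
      refine Finset.lexKey_lt_iff.2 ⟨c, hc, ?_, fun x hx hxC => ?_⟩
      · rw [hBj]
        simp [hjne.symm]
      · rw [hBj] at hx
        rcases Finset.mem_insert.1 hx with rfl | hx
        · exact hcj
        · exact absurd (Finset.mem_of_mem_erase hx) hxC
    · rw [Finset.sum_eq_zero, zero_smul]
      · exact zero_mem _
      · intro j hj
        rw [if_neg fun h => hex ⟨j, hj, h⟩, mul_zero]
  have := Submodule.smul_mem _ (faceSign R C c) hmem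
  rwa [smul_smul, faceSign_mul_self, one_smul] at this

theorem span_betaNbcBases :
    Submodule.span R (Set.range fun B : {B : Finset (Fin n) // A.IsBetaNbcBase B} =>
      A.listClass R (A.flagList B)) = ⊤ := by
  rw [eq_top_iff, ← A.span_listClass_flagToList R, Submodule.span_le]
  rintro _ ⟨x, rfl⟩
  rw [SetLike.mem_coe]
  change A.listClass R (A.flagToList x) ∈ _
  rw [listClass_eq_sum]
  exact sum_mem fun B hB => Submodule.smul_mem _ _ (A.listClass_mem_span R hB)

/-- A vanishing combination is a coboundary, so it pairs to zero with the cycle of the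
lexicographically least base whose coefficient is nonzero; that pairing equals the coefficient
itself. -/
theorem linearIndependent_betaNbcBases :
    LinearIndependent R fun B : {B : Finset (Fin n) // A.IsBetaNbcBase B} =>
      A.listClass R (A.flagList B) := by
  classical
  rw [linearIndependent_iff']
  intro s a hsum
  by_contra! hne
  obtain ⟨B, hB, hmin⟩ := Finset.exists_min_image (s.filter fun B => a B ≠ 0)
    (fun B => B.1.lexKey) (by
      obtain ⟨B, hB, hBa⟩ := hne
      exact ⟨B, Finset.mem_filter.2 ⟨hB, hBa⟩⟩)
  obtain ⟨hBs, hBa⟩ := Finset.mem_filter.1 hB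
  obtain ⟨z, hz, hzB, hcyc⟩ := B.2.exists_cycle R
  apply hBa
  have hbase : ∀ D, D ∈ A.nbcBases → A.IsNbcSet D ∧ D.card = A.rank := fun D hD =>
    ⟨(A.mem_nbcBases.1 hD).2, IsBase.card_eq A (A.mem_nbcBases.1 hD).1⟩
  set f : PosetFlag.Cochain A.FolkmanVertex R A.rank :=
    ∑ D ∈ s, a D • PosetFlag.dual R (A.xi D.2.1) with hfdef
  have hf : f ∈ PosetFlag.coboundaries A.FolkmanVertex R A.rank := by
    rw [← cohomologyMap_eq_zero_iff, hfdef, map_sum, ← hsum]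
    refine Finset.sum_congr rfl fun D _ => ?_
    rw [map_smul, A.listClass_flagList R D.2.1]
    rfl
  have hext : A.extendCochain f = ∑ D ∈ s, a D • Pi.single (A.flagList D) 1 := by
    funext l
    rw [Finset.sum_apply]
    by_cases hl : ∃ x : PosetFlag A.FolkmanVertex A.rank, A.flagToList x = l
    · obtain ⟨x, rfl⟩ := hl
      rw [extendCochain_apply, hfdef, Finset.sum_apply]
      refine Finset.sum_congr rfl fun D _ => ?_
      simp only [Pi.smul_apply, PosetFlag.dual, Pi.single_apply, ← A.flagToList_xi D.2.1,
        A.flagToList_injective.eq_iff]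
    · rw [extendCochain, Function.extend_apply' _ _ _ hl]
      refine (Finset.sum_eq_zero fun D _ => ?_).symm
      rw [Pi.smul_apply, Pi.single_eq_of_ne, smul_zero]
      rintro rfl
      exact hl ⟨A.xi D.2.1, A.flagToList_xi D.2.1⟩
  have hpair := A.sum_mul_flagSum_eq_zero
    (fun D hD => ⟨(hbase D (hz D hD).1).1.isIndependent, (hbase D (hz D hD).1).2⟩) hcyc hf
  have hval : ∀ D : Finset (Fin n), z D * A.flagSum R A.rank D (A.extendCochain f) =
      ∑ E ∈ s, if D = E.1 then a E * z E.1 else 0 := by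
    intro D
    by_cases hD : z D = 0
    · rw [hD, zero_mul]
      refine (Finset.sum_eq_zero fun E _ => ?_).symm
      split_ifs with h
      · rw [← h, hD, mul_zero]
      · rfl
    · rw [hext, map_sum, Finset.mul_sum]
      refine Finset.sum_congr rfl fun E _ => ?_
      have hDn := hbase D (hz D hD).1
      have hEn := hbase E.1 E.2.mem_nbcBases
      rw [map_smul, A.flagSum_single_flagList R A.rank D E.1 hDn.1 hEn.1 hDn.2 hEn.2]
      split_ifs with h
      · rw [h, smul_eq_mul]
        ring
      · simp
  rw [Finset.sum_congr rfl fun D _ => hval D, Finset.sum_comm] at hpair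
  simp only [Finset.sum_ite_eq', Finset.mem_univ, if_true] at hpair
  -- The cycle lives on bases up to `B`, the nonzero coefficients on bases from `B` onwards; only
  -- `B` is common.
  rw [Finset.sum_eq_single B] at hpair
  · rwa [hzB, mul_one] at hpair
  · intro E hE hEB
    by_cases hEa : a E = 0
    · rw [hEa, zero_mul]
    · have h1 := hmin E (Finset.mem_filter.2 ⟨hE, hEa⟩)
      have h2 : z E.1 = 0 := by
        by_contra h2
        exact hEB (Subtype.ext (Finset.lexKey_injective (le_antisymm (hz _ h2).2 h1)))
      rw [h2, mul_zero]
  · exact fun h => absurd hBs h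

end Cohomology

end HyperplaneArrangement

theorem theorem2p6 {V P : Type*} [AddCommGroup V] [Module ℂ V] [FiniteDimensional ℂ V]
    [AddTorsor V P] {n : ℕ} (A : HyperplaneArrangement ℂ P n) (R : Type*) [CommRing R] :
    ∃ b : Module.Basis {B : Finset (Fin n) // A.IsBetaNbcBase B} R (A.FolkmanCohomology R),
      ∀ B, b B = A.cohomologyClass (PosetFlag.dual R (A.xi B.2.1)) := by
  refine ⟨Module.Basis.mk (A.linearIndependent_betaNbcBases R) (A.span_betaNbcBases R).ge,
    fun B => ?_⟩
  rw [Module.Basis.mk_apply, A.listClass_flagList R B.2.1]
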